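/- Let $\mathbf g$ be a simple complex Lie algebra with simple roots $\alpha_1,\dots,\alpha_\ell\in\mathbf h^*$, invariant form $(\cdot,\cdot)$ normalized so that long roots have squared length $2$, coroots $\alpha_i^\vee=2\alpha_i/(\alpha_i,\alpha_i)$, fundamental weights $\omega_i$ with $(\omega_i,\alpha_j^\vee)=\delta_{ij}$, Weyl group $W$, half-sums $\rho,\rho^\vee$ of the positive roots and of the positive coroots, $r^\vee$ the ratio of the squared lengths of long and short roots, $r_i=r^\vee(\alpha_i,\alpha_i)/2$, and $C_{ij}=2(\alpha_i,\alpha_j)/(\alpha_i,\alpha_i)$. Let $q=e^{\hbar}$ and $t=q^\beta=e^{\beta\hbar}$ with $\hbar,\beta\in\mathbb C$, put $q^x=e^{\hbar x}$ for $x\in\mathbb C$, and let $q,t$ be generic in the sense that $q^mt^n=1$ with $m,n\in\mathbb Z$ only for $m=n=0$. Fields. Let $C_{ij}(q,t)=(q^{r_i}t^{-1}+q^{-r_i}t)\delta_{ij}-[2\delta_{ij}-C_{ij}]_q$, with $[n]_q=(q^n-q^{-n})/(q-q^{-1})$. The deformed Heisenberg algebra has generators $a_i[m]$, $m\in\mathbb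 Z$, with $[a_i[m],a_j[n]]=\frac1m(q^m-q^{-m})(t^m-t^{-m})[r_i]_{q^m}C_{ij}(q^m,t^m)\,\delta_{m+n,0}$ (and $0$ for $m=0$), and $y_i[m]$ is defined by $a_i[m]=\sum_jC_{ji}(q^m,t^m)y_j[m]$. Put $$Y_i(z)=t^{2(\rho^\vee,\omega_i)}q^{-2r^\vee(\rho,\omega_i)+2y_i[0]}:\!\exp\Big(\sum_{m\ne0}y_i[m]z^{-m}\Big)\!:,\qquad A_i(z)=t^{2(\rho^\vee,\alpha_i)}q^{-2r^\vee(\rho,\alpha_i)+2a_i[0]}:\!\exp\Big(\sum_{m\ne0}a_i[m]z^{-m}\Big)\!: .$$ For $\mu\in\mathbf h^*$ the Fock module $F(\mu)$ is freely generated by the $a_i[m]$, $m<0$, from a vacuum $|\mu\rangle$ with $a_i[0]|\mu\rangle=(\mu,\alpha_i)|\mu\rangle$ and $a_i[m]|\mu\rangle=0$ for $m>0$. Generators. For each $i$ let $T_i(z)=\sum_mT_i[m]z^{-m}$ be a field of the following kind: (a) $T_i(z)$ is $Y_i(z)$ plus a finite linear combination of monomials $:\!Y_i(z)A_{j_1}(zq^{a_1}t^{b_1})^{-1}\cdots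 A_{j_k}(zq^{a_k}t^{b_k})^{-1}\!:$ with $k\ge1$ and $a_s,b_s\in\mathbb Z$; (b) in each direction $j=1,\dots,\ell$, $T_i(z)$ is pasted together from $\mathfrak{sl}_2$ strings, i.e. it is a finite linear combination of expressions $$\sum_{S\subseteq\{1,\dots,m\}}\gamma_S\;:\!U(z)\prod_{s=1}^mY_j(z_s)\prod_{s\in S}A_j(z_sq^{-r_j}t)^{-1}\!:\;,\qquad \gamma_S=\prod_{s\in S,\,l\notin S}g\Big(\frac{z_s}{z_l}\Big),\qquad g(\zeta)=\frac{(Q-Q^{-1}\zeta)(t^{-1}-t\zeta)}{(1-\zeta)(Qt^{-1}-Q^{-1}t\zeta)},\qquad Q=q^{r_j},$$ where $m\ge0$, $U(z)$ is a normal ordered monomial in the $Y_k(zq^at^b)^{\pm1}$ with $k\neq j$ and $a,b\in\mathbb Z$, and $z_s\in zq^{\mathbb Z}t^{\mathbb Z}$. If the $z_s$ are not in general position (some denominator vanishes), the linear combination is understood as a limit of linear combinations (with coefficients that may vary) of such expressions whose coefficients $\gamma_S$ are evaluated at points in general position tending to the $z_s$, the limit being taken for the coefficient of each normal ordered monomial.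 Lemma. Then $T_i[0]|\mu\rangle=h_i(\mu)|\mu\rangle$ with $h_i(\mu)\in\mathbb C$, for all $i$ and all $\mu\in\mathbf h^*$. For $w\in W$ let $$w*\mu=w(\mu-r^\vee\rho+\beta\rho^\vee)+(r^\vee\rho-\beta\rho^\vee).$$ (1) For all $\mu,\mu'\in\mathbf h^*$: $h_i(\mu)=h_i(\mu')$ for all $i=1,\dots,\ell$ if and only if there is $w\in W$ with $\mu'\in w*\mu+\frac{\pi\sqrt{-1}}{\hbar}\,\mathbb Z\{\alpha_1^\vee,\dots,\alpha_\ell^\vee\}$ (that is, $q^{2(\mu',\lambda)}=q^{2(w*\mu,\lambda)}$ for all integral weights $\lambda$). (2) Let $P_{\mathbb Q}$ be the rational span of the roots. For all $\mu,\mu'\in P_{\mathbb Q}+\beta P_{\mathbb Q}$: $h_i(\mu)=h_i(\mu')$ for all $i=1,\dots,\ell$ if and only if there is $w\in W$ with $\mu'=w*\mu$. -/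

import Mathlib

noncomputable section

namespace DeformedW

/-! ## Root data

A simple Lie algebra `g` over `ℂ` enters through its (irreducible, reduced, crystallographic)
root system `P` in `V = h^*`, with simple roots `α_i = P.root i`, `i ∈ b.support`. -/

section RootData

variable {ι V V' : Type*} [Fintype ι] [AddCommGroup V] [Module ℂ V]
  [AddCommGroup V'] [Module ℂ V'] (P : RootPairing ι ℂ V V') [P.IsCrystallographic]

/-- Squared length of the `i`-th root for the canonical form
`(x, y) ↦ ∑_k ⟨x, α_k^∨⟩ ⟨y, α_k^∨⟩`; a positive integer. -/
def rootSq (i : ι) : ℕ := ∑ k, (P.pairingIn ℤ i k).natAbs ^ 2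

/-- The largest value of `rootSq` (long roots). -/
def longSq : ℕ := Finset.univ.sup (rootSq P)

/-- The smallest value of `rootSq` (short roots). -/
def shortSq : ℕ := sInf (Set.range (rootSq P))

/-- The dual tier number `r^∨`: the squared length ratio of long to short roots, i.e.
`1` for types `A, D, E`, `2` for types `B, C, F`, and `3` for type `G`. -/
def dualTier : ℕ := longSq P / shortSq P

/-- The invariant bilinear form on `h^*`, normalized so that long roots have squared length `2`. -/
def form (x y : V) : ℂ := 2 / (longSq P : ℂ) * P.RootForm x y

/-- The integer `r_i = r^∨ (α_i, α_i) / 2`. -/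
def rNum (i : ι) : ℕ := rootSq P i / shortSq P

/-- The coroot `α_i^∨ = 2 α_i / (α_i, α_i)`, as an element of `h^*`. -/
def corootVec (i : ι) : V := (2 / form P (P.root i) (P.root i)) • P.root i

variable {P}

open Classical in
/-- The Weyl vector `ρ`, half the sum of the positive roots. -/
def rho (b : P.Base) : V := (1 / 2 : ℂ) • ∑ i : ι with b.IsPos i, P.root i

open Classical in
/-- The dual Weyl vector `ρ^∨`, half the sum of the positive coroots, as an element of `h^*`. -/
def rhoCheck (b : P.Base) : V := (1 / 2 : ℂ) • ∑ i : ι with b.IsPos i, corootVec P i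

/-- The Cartan matrix `C_{ij} = 2 (α_i, α_j) / (α_i, α_i) = ⟨α_j, α_i^∨⟩`. -/
def cartan (b : P.Base) (i j : b.support) : ℤ := P.pairingIn ℤ j i

/-- The incidence matrix `I_{ij} = 2 δ_{ij} - C_{ij}`, whose entries are non-negative. -/
def incidence [DecidableEq ι] (b : P.Base) (i j : b.support) : ℕ :=
  ((if i = j then 2 else 0) - cartan b i j).toNat

/-- The `q`-integer `[n]_x = (x ^ n - x ^ (-n)) / (x - x⁻¹) = x^(n-1) + x^(n-3) + ⋯ + x^(1-n)`. -/
def qInt (n : ℕ) (x : ℂ) : ℂ := ∑ s ∈ Finset.range n, x ^ ((n : ℤ) - 1 - 2 * s)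

/-- The deformed Cartan matrix
`C_{ij}(x, y) = (x ^ r_i * y⁻¹ + x ^ (-r_i) * y) δ_{ij} - [I_{ij}]_x`. -/
def deformedCartan [DecidableEq ι] (b : P.Base) (x y : ℂ) : Matrix b.support b.support ℂ :=
  Matrix.of fun i j =>
    (if i = j then x ^ (rNum P i : ℤ) * y⁻¹ + x ^ (-(rNum P i : ℤ)) * y else 0)
      - qInt (incidence b i j) x

/-- The matrix `B(x, y) = D(x, y) C(x, y)`, where `D_{ij}(x, y) = [r_i]_x δ_{ij}`. -/
def deformedSymm [DecidableEq ι] (b : P.Base) (x y : ℂ) : Matrix b.support b.support ℂ :=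
  Matrix.diagonal (fun i : b.support => qInt (rNum P i) x) * deformedCartan b x y

/-- The fundamental weights: `α_i = ∑_j C_{ji} ω_j`, equivalently `(ω_i, α_j^∨) = δ_{ij}`. -/
def fundWeight [DecidableEq ι] (b : P.Base) (i : b.support) : V :=
  ∑ j : b.support, (deformedCartan b 1 1)⁻¹ j i • P.root j

/-- The shift `r^∨ ρ - β ρ^∨`. -/
def weylShift (b : P.Base) (β : ℂ) : V := (dualTier P : ℂ) • rho b - β • rhoCheck b

/-- The shifted Weyl group action
`w * μ = w (μ - r^∨ ρ + β ρ^∨) + (r^∨ ρ - β ρ^∨)`. -/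
def shiftedAction (b : P.Base) (β : ℂ) (w : P.weylGroup) (μ : V) : V :=
  w • (μ - weylShift b β) + weylShift b β

/-- `μ ∈ P_ℚ + β P_ℚ`, where `P_ℚ` is the rational span of the roots (equivalently of the
weights, or of the coweights). -/
def IsRationalWeight (b : P.Base) (β : ℂ) (μ : V) : Prop :=
  ∃ x y : b.support → ℚ, μ = ∑ i : b.support, ((x i : ℂ) + β * (y i : ℂ)) • P.root i

end RootData

/-! ## The deformed Heisenberg algebra and its Fock modules

The deformation parameters are `q = exp ħ` and `t = q ^ β = exp (β ħ)`; complex powers of `q` are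
`q ^ x = exp (ħ x)`. -/

section Fock

variable {ι V V' : Type*} [Fintype ι] [DecidableEq ι] [AddCommGroup V] [Module ℂ V]
  [AddCommGroup V'] [Module ℂ V'] {P : RootPairing ι ℂ V V'} [P.IsCrystallographic]
  (b : P.Base) (ħ β : ℂ)

/-- The parameter `q`. -/
def qPar (ħ : ℂ) : ℂ := Complex.exp ħ

/-- The parameter `t = q ^ β`. -/
def tPar (ħ β : ℂ) : ℂ := Complex.exp (β * ħ)

/-- The space underlying each Fock module `F(μ)`: it is freely generated from the vacuum `1 = |μ⟩`
by the commuting operators `a_i[-m]`, `m ≥ 1`; the variable `X (i, n)` stands for `a_i[-(n+1)]`. -/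
abbrev Fock : Type _ := MvPolynomial (b.support × ℕ) ℂ

/-- The action of `a_i[m]` on `F(μ)`: multiplication for `m < 0`, the scalar `(μ, α_i)` for `m = 0`,
and for `m > 0` the derivation that kills the vacuum and satisfies
`[a_i[m], a_j[-m]] = (1/m) (q^m - q^(-m)) (t^m - t^(-m)) B_{ij}(q^m, t^m)`. -/
def aMode (μ : V) (i : b.support) : ℤ → Module.End ℂ (Fock b)
  | Int.negSucc n => LinearMap.mulLeft ℂ (MvPolynomial.X (i, n))
  | Int.ofNat 0 => form P μ (P.root i) • 1
  | Int.ofNat (n + 1) => ∑ j : b.support,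
      ((1 / ((n : ℂ) + 1)) * (qPar ħ ^ (n + 1) - (qPar ħ ^ (n + 1))⁻¹)
        * (tPar ħ β ^ (n + 1) - (tPar ħ β ^ (n + 1))⁻¹)
        * deformedSymm b (qPar ħ ^ (n + 1)) (tPar ħ β ^ (n + 1)) i j) •
        (MvPolynomial.pderiv (R := ℂ) (j, n)).toLinearMap

/-- The fundamental weight type generators, `a_i[m] = ∑_j C_{ji}(q^m, t^m) y_j[m]`. -/
def yMode (μ : V) (i : b.support) (m : ℤ) : Module.End ℂ (Fock b) :=
  ∑ j : b.support, (deformedCartan b (qPar ħ ^ m) (tPar ħ β ^ m))⁻¹ j i • aMode b ħ β μ j m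

/-- Exponents of the normal ordered monomials in the fields `Y_k(z q^a t^c)`:
`u` stands for `:∏ Y_k(z q^a t^c) ^ u(k, a, c):`. -/
abbrev YMonomial : Type _ := (b.support × ℤ × ℤ) →₀ ℤ

/-- Finite linear combinations of normal ordered monomials in the `Y_k(z q^a t^c)^{±1}`. -/
abbrev YField : Type _ := YMonomial b →₀ ℂ

variable {b}

/-- For `:∏ Y_k(z q^a t^c) ^ u(k, a, c): = (zero mode part) :exp (∑_{m ≠ 0} o[m] z^(-m)):`,
the operator `o[m]` on `F(μ)`. -/
def oscMode (μ : V) (u : YMonomial b) (m : ℤ) : Module.End ℂ (Fock b) :=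
  u.sum fun k e => ((e : ℂ) * (qPar ħ ^ k.2.1 * tPar ħ β ^ k.2.2) ^ (-m)) • yMode b ħ β μ k.1 m

/-- The zero mode part of a normal ordered monomial on `F(μ)`. The zero mode part of `Y_k(z)` is
`t ^ (2 (ρ^∨, ω_k)) q ^ (-2 r^∨ (ρ, ω_k) + 2 y_k[0])`, and `y_k[0]` acts on `F(μ)` as `(μ, ω_k)`. -/
def zeroModePart (μ : V) (u : YMonomial b) : ℂ :=
  u.prod fun k e =>
    (Complex.exp (ħ * (2 * β * form P (rhoCheck b) (fundWeight b k.1)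
      - 2 * (dualTier P : ℂ) * form P (rho b) (fundWeight b k.1)
      + 2 * form P μ (fundWeight b k.1)))) ^ e

/-- The coefficient of `ζ^n` in `exp (∑_{m ≥ 1} A_m ζ^m)`, for pairwise commuting operators `A_m`
(powers beyond the `n`-th do not contribute to it). -/
def expCoeff {E : Type*} [AddCommGroup E] [Module ℂ E] (A : ℕ → Module.End ℂ E) (n : ℕ) :
    Module.End ℂ E :=
  ∑ r ∈ Finset.range (n + 1), ((r.factorial : ℂ)⁻¹) •
    PowerSeries.coeff n ((PowerSeries.mk fun m => if m = 0 then 0 else A m) ^ r)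

/-- The mode `U[n]` on `F(μ)` of a normal ordered monomial `U(z) = ∑_n U[n] z^(-n)`: creation
operators stand to the left of annihilation operators. On a given vector only finitely many `k`
contribute. -/
def monomialMode (μ : V) (u : YMonomial b) (n : ℤ) (v : Fock b) : Fock b :=
  zeroModePart ħ β μ u • ∑ᶠ k : ℕ, if n ≤ (k : ℤ) then
    expCoeff (fun m => oscMode ħ β μ u (-(m : ℤ))) ((k : ℤ) - n).toNat
      (expCoeff (fun m => oscMode ħ β μ u (m : ℤ)) k v) else 0

/-- The mode `T[n]` on `F(μ)` of a field `T(z) = ∑_n T[n] z^(-n)`. -/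
def fieldMode (μ : V) (T : YField b) (n : ℤ) (v : Fock b) : Fock b :=
  T.sum fun u c => c • monomialMode ħ β μ u n v

/-- The vacuum component of `T[0] |μ⟩`; it is the eigenvalue of `T[0]` on `|μ⟩`. -/
def highestWeight (T : YField b) (μ : V) : ℂ :=
  MvPolynomial.constantCoeff (fieldMode ħ β μ T 0 1)

/-! ## The generating fields and the pasting of `sl_2` directions -/

/-- The monomial `Y_i(z q^a t^c)`. -/
def yMon (i : b.support) (a c : ℤ) : YMonomial b := Finsupp.single (i, a, c) 1

/-- The monomial `A_j(z q^a t^c)`, where, by `a_j[m] = ∑_k C_{kj}(q^m, t^m) y_k[m]`,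
`A_j(z) = :Y_j(z q^{r_j} t^{-1}) Y_j(z q^{-r_j} t) ∏_{k ≠ j} ∏_s Y_k(z q^{I_{kj} - 1 - 2 s})^{-1}:`
with `s` running over `0, …, I_{kj} - 1`. -/
def aMon (j : b.support) (a c : ℤ) : YMonomial b :=
  yMon j (a + rNum P j) (c - 1) + yMon j (a - rNum P j) (c + 1)
    - ∑ k ∈ Finset.univ.erase j, ∑ s ∈ Finset.range (incidence b k j),
        yMon k (a + (incidence b k j - 1 - 2 * s)) c

/-- The monomial `:U(z) ∏_i Y_j(z_i) ∏_{i ∈ S} A_j(z_i q^{-r_j} t)^{-1}:`, `z_i = z q^{a_i} t^{c_i}`,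
with `(a_i, c_i) = p i`. -/
def stringMon (j : b.support) (u : YMonomial b) {m : ℕ} (p : Fin m → ℤ × ℤ) (S : Finset (Fin m)) :
    YMonomial b :=
  u + ∑ i, yMon j (p i).1 (p i).2 - ∑ i ∈ S, aMon j ((p i).1 - rNum P j) ((p i).2 + 1)

/-- The coefficient of the term indexed by `S` (the set of minus signs) in the element
`T(z) = ∑_S γ_S :∏_{i ∉ S} Y(z_i) ∏_{i ∈ S} Y(z_i) A(z_i Q^{-1} t)^{-1}:` of the commutant of the
screening operators of `sl_2` with parameters `Q, t`, for `z_i = z x_i` in general position: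
`γ_S = ∏_{i ∈ S, l ∉ S} g(x_i / x_l)`, with
`g(ζ) = (Q - Q⁻¹ ζ) (t⁻¹ - t ζ) / ((1 - ζ) (Q t⁻¹ - Q⁻¹ t ζ))`. -/
def stringCoeff (Q t : ℂ) {m : ℕ} (x : Fin m → ℂ) (S : Finset (Fin m)) : ℂ :=
  ∏ i ∈ S, ∏ l ∈ Sᶜ,
    ((Q - Q⁻¹ * (x i / x l)) * (t⁻¹ - t * (x i / x l))) /
      ((1 - x i / x l) * (Q * t⁻¹ - Q⁻¹ * t * (x i / x l)))

/-- The points `x_i` are nonzero and no denominator of `stringCoeff` vanishes. -/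
def InGeneralPosition (Q t : ℂ) {m : ℕ} (x : Fin m → ℂ) : Prop :=
  (∀ i, x i ≠ 0) ∧ ∀ i l, i ≠ l → 1 - x i / x l ≠ 0 ∧ Q * t⁻¹ - Q⁻¹ * t * (x i / x l) ≠ 0

/-- In direction `j`, the field `T(z)` is pasted together from `sl_2` strings
`∑_S γ_S :U(z) ∏_i Y_j(z_i) ∏_{i ∈ S} A_j(z_i q^{-r_j} t)^{-1}:`,
where `U` is a monomial in the `Y_k`, `k ≠ j`, the points are `z_i = z q^{a_i} t^{c_i}`, and `γ_S` is
`stringCoeff` for `Q = q^{r_j}`: it is a finite linear combination of such strings. As the points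
need not be in general position, the linear combination is understood as the limit of
linear combinations (with coefficients `κ`) of strings for points in general position that tend to
the `z_i`, taken for each normal ordered monomial. For fixed points `x r n = (z_i / z)_i` in general
position and fixed `κ` this is just a linear combination of strings. -/
def IsPasted (j : b.support) (T : YField b) : Prop :=
  ∃ (N : ℕ) (m : Fin N → ℕ) (u : Fin N → YMonomial b) (p : ∀ r, Fin (m r) → ℤ × ℤ)
    (x : ∀ r, ℕ → Fin (m r) → ℂ) (κ : Fin N → ℕ → ℂ),
    (∀ r, ∀ a c : ℤ, u r (j, a, c) = 0) ∧
    (∀ r n, InGeneralPosition (qPar ħ ^ rNum P j) (tPar ħ β) (x r n)) ∧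
    (∀ r i, Filter.Tendsto (fun n => x r n i) Filter.atTop
      (nhds (qPar ħ ^ (p r i).1 * tPar ħ β ^ (p r i).2))) ∧
    ∀ v : YMonomial b, Filter.Tendsto
      (fun n => ∑ r, κ r n * ∑ S : Finset (Fin (m r)) with stringMon j (u r) (p r) S = v,
        stringCoeff (qPar ħ ^ rNum P j) (tPar ħ β) (x r n) S)
      Filter.atTop (nhds (T v))

/-- The field `T(z)` has the form of the `i`-th generator of the deformed `W`-algebra: it is
`Y_i(z)` plus a finite linear combination of monomials
`:Y_i(z) A_{j_1}(z q^{a_1} t^{c_1})^{-1} ⋯ A_{j_k}(z q^{a_k} t^{c_k})^{-1}:`, `k ≥ 1`, and in each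
`sl_2` direction `j` it is pasted together from `sl_2` strings. -/
structure IsGenerator (i : b.support) (T : YField b) : Prop where
  leading : T (yMon i 0 0) = 1
  lower : ∀ u ∈ T.support, ∃ L : List (b.support × ℤ × ℤ),
    u = yMon i 0 0 - (L.map fun k => aMon k.1 k.2.1 k.2.2).sum
  pasted : ∀ j : b.support, IsPasted ħ β j T

end Fock

end DeformedW

end

/-! Annihilation operators kill the vacuum, so `T_i[0]` acts on it through zero modes only, and
`h_i(μ)` is the sum over the monomials of `T_i` of the coefficient times `q^{2(μ - r^∨ρ + βρ^∨,
λ)}`, with `λ` the weight of the monomial. Thus `h_i(μ)` is the value of an element `χ_i` of the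
group algebra of the weight lattice (`fieldChar`) at a character attached to `μ`
(`weightCharacter`).

The heart is that `χ_i` is `W`-invariant. On a string with `m` points, `s_j` exchanges the weights
of the terms with `|S| = k` and with `|S| = m - k`, so invariance amounts to equality of the sums of
`γ_S` over these two sizes. This is a trigonometric identity of Ruijsenaars
(`sum_stringCoeff_reverse`), proved by interpolation in one of the points. It survives the limit in
the pasting condition, as the weights do not depend on the positions of the points.

Since `χ_i` is `e^{ω_i}` plus lower terms, a triangular induction shows that the `χ_i` generate all
invariants (`eval_eq_of_forall_fundamental`). Two characters that agree on the invariants are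
`W`-conjugate, by linear independence of characters (`exists_characterSMul_eq`). Taking logarithms
leaves an ambiguity in `πi/ħ` times the coroot lattice. For weights in `P_ℚ + β P_ℚ` a nonzero
ambiguity would, after clearing denominators, give a nontrivial relation `q^m t^n = 1`. -/

noncomputable section

namespace DeformedW

/-! ### Ruijsenaars' identity by polynomial interpolation -/

section SourceIdentity

open Polynomial Finset

variable {K α : Type*} [Field K] [DecidableEq α]

/-- The factor `g(a / y)` in homogeneous form, with `p = Q t⁻¹`. -/
def pairFactor (Q t a y : K) : K :=
  ((Q * y - Q⁻¹ * a) * (t⁻¹ * y - t * a)) / ((y - a) * (Q * t⁻¹ * y - Q⁻¹ * t * a))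

/-- The weight `∏_{i ∈ S, l ∈ s \ S} g(x_i / x_l)` of a subset `S` of `s`. -/
def subsetWeight (Q t : K) (x : α → K) (s S : Finset α) : K :=
  ∏ i ∈ S, ∏ l ∈ s \ S, pairFactor Q t (x i) (x l)

lemma subsetWeight_insert_left (Q t : K) (x : α → K) {s S : Finset α} {a : α} (ha : a ∉ s)
    (hS : S ⊆ s) : subsetWeight Q t x (insert a s) S =
      (∏ i ∈ S, pairFactor Q t (x i) (x a)) * subsetWeight Q t x s S := by
  unfold subsetWeight
  rw [← prod_mul_distrib]
  refine prod_congr rfl fun i _ => ?_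
  rw [insert_sdiff_of_notMem _ (fun h => ha (hS h)), prod_insert (by simp [ha])]

lemma subsetWeight_insert_both (Q t : K) (x : α → K) {s S : Finset α} {a : α} (ha : a ∉ s)
    (hS : S ⊆ s) : subsetWeight Q t x (insert a s) (insert a S) =
      (∏ l ∈ s \ S, pairFactor Q t (x a) (x l)) * subsetWeight Q t x s S := by
  unfold subsetWeight
  rw [prod_insert (fun h => ha (hS h)), insert_sdiff_insert, sdiff_insert_of_notMem ha]

/-- Common denominator of `g(X / y)` and `g(y / X)`, as a polynomial in `X`. -/
def denPoly (Q t y : K) : K[X] :=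
  (X - C y) * (C (Q * t⁻¹ * y) - C (Q⁻¹ * t) * X) * (C (Q * t⁻¹) * X - C (Q⁻¹ * t * y))

/-- Numerator of `g(X / y)` over `denPoly`. -/
def numPolyLeft (Q t y : K) : K[X] :=
  -((C (Q * y) - C Q⁻¹ * X) * (C (t⁻¹ * y) - C t * X) * (C (Q * t⁻¹) * X - C (Q⁻¹ * t * y)))

/-- Numerator of `g(y / X)` over `denPoly`. -/
def numPolyRight (Q t y : K) : K[X] :=
  (C Q * X - C (Q⁻¹ * y)) * (C t⁻¹ * X - C (t * y)) * (C (Q * t⁻¹ * y) - C (Q⁻¹ * t) * X)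

lemma natDegree_denPoly (Q t y : K) : (denPoly Q t y).natDegree ≤ 3 := by
  unfold denPoly; compute_degree

lemma natDegree_numPolyLeft (Q t y : K) : (numPolyLeft Q t y).natDegree ≤ 3 := by
  unfold numPolyLeft; compute_degree

lemma natDegree_numPolyRight (Q t y : K) : (numPolyRight Q t y).natDegree ≤ 3 := by
  unfold numPolyRight; compute_degree

lemma eval_denPoly (Q t y a : K) : (denPoly Q t y).eval a =
    (a - y) * (Q * t⁻¹ * y - Q⁻¹ * t * a) * (Q * t⁻¹ * a - Q⁻¹ * t * y) := by
  simp [denPoly]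

lemma eval_numPolyLeft {Q t y a : K} (h : (denPoly Q t y).eval a ≠ 0) :
    (numPolyLeft Q t y).eval a = pairFactor Q t a y * (denPoly Q t y).eval a := by
  rw [eval_denPoly] at h ⊢
  have h1 : a - y ≠ 0 := fun h' => h (by rw [h']; ring)
  have h1' : y - a ≠ 0 := fun h' => h1 (by linear_combination -h')
  have h2 : Q * t⁻¹ * y - Q⁻¹ * t * a ≠ 0 := fun h' => h (by rw [h']; ring)
  rw [pairFactor, div_mul_eq_mul_div, eq_div_iff (mul_ne_zero h1' h2)]
  simp [numPolyLeft]; ring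

lemma eval_numPolyRight {Q t y a : K} (h : (denPoly Q t y).eval a ≠ 0) :
    (numPolyRight Q t y).eval a = pairFactor Q t y a * (denPoly Q t y).eval a := by
  rw [eval_denPoly] at h ⊢
  have h1 : a - y ≠ 0 := fun h' => h (by rw [h']; ring)
  have h2 : Q * t⁻¹ * a - Q⁻¹ * t * y ≠ 0 := fun h' => h (by rw [h']; ring)
  rw [pairFactor, div_mul_eq_mul_div, eq_div_iff (mul_ne_zero h1 h2)]
  simp [numPolyRight]; ring

/-- With `p = Q t⁻¹`, this is the functional equation `g(p² / η) = g(η)`, cleared of the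
denominators in the variable. -/
lemma eval_numPolyLeft_mul {Q t y a : K} (hQ : Q ≠ 0) (ht : t ≠ 0) (h1 : a - y ≠ 0)
    (h2 : Q * t⁻¹ * a - Q⁻¹ * t * y ≠ 0) :
    (numPolyLeft Q t y).eval ((Q * t⁻¹) ^ 2 * a) =
      pairFactor Q t y a * (denPoly Q t y).eval ((Q * t⁻¹) ^ 2 * a) := by
  rw [pairFactor, div_mul_eq_mul_div, eq_div_iff (mul_ne_zero h1 h2), eval_denPoly]
  simp [numPolyLeft]; field_simp; ring

lemma eval_numPolyRight_mul {Q t y a : K} (hQ : Q ≠ 0) (ht : t ≠ 0) (h1 : y - a ≠ 0)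
    (h2 : Q * t⁻¹ * y - Q⁻¹ * t * a ≠ 0) :
    (numPolyRight Q t y).eval ((Q⁻¹ * t) ^ 2 * a) =
      pairFactor Q t a y * (denPoly Q t y).eval ((Q⁻¹ * t) ^ 2 * a) := by
  rw [pairFactor, div_mul_eq_mul_div, eq_div_iff (mul_ne_zero h1 h2), eval_denPoly]
  simp [numPolyRight]; field_simp; ring

/-- `∑_S (c(|S|) - c(|s| - |S|)) γ_S`, cleared of denominators involving one further point `X`. -/
def clearedPoly (Q t : K) (x : α → K) (c : ℕ → K) (r : Finset α) : K[X] :=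
  ∑ S ∈ r.powerset, C (subsetWeight Q t x r S) *
    (C (c (#S + 1) - c (#r - #S)) * ((∏ l ∈ S, denPoly Q t (x l)) *
        ∏ l ∈ r \ S, numPolyLeft Q t (x l)) +
      C (c #S - c (#r + 1 - #S)) * ((∏ l ∈ S, numPolyRight Q t (x l)) *
        ∏ l ∈ r \ S, denPoly Q t (x l)))

lemma natDegree_prod_mul_prod_le {r S : Finset α} (hS : S ⊆ r) (f g : α → K[X])
    (hf : ∀ i, (f i).natDegree ≤ 3) (hg : ∀ i, (g i).natDegree ≤ 3) :
    ((∏ l ∈ S, f l) * ∏ l ∈ r \ S, g l).natDegree ≤ 3 * #r := by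
  refine natDegree_mul_le.trans ?_
  have h1 := (natDegree_prod_le S f).trans (sum_le_card_nsmul S _ 3 fun i _ => hf i)
  have h2 := (natDegree_prod_le (r \ S) g).trans (sum_le_card_nsmul (r \ S) _ 3 fun i _ => hg i)
  have h3 := card_sdiff_add_card_eq_card hS
  simp only [smul_eq_mul] at h1 h2
  lia

lemma natDegree_clearedPoly (Q t : K) (x : α → K) (c : ℕ → K) (r : Finset α) :
    (clearedPoly Q t x c r).natDegree ≤ 3 * #r := by
  refine natDegree_sum_le_of_forall_le _ _ fun S hS => ?_
  have hS := mem_powerset.1 hS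
  refine (natDegree_C_mul_le _ _).trans (natDegree_add_le_of_degree_le ?_ ?_)
  · exact (natDegree_C_mul_le _ _).trans (natDegree_prod_mul_prod_le hS _ _
      (fun _ => natDegree_denPoly ..) (fun _ => natDegree_numPolyLeft ..))
  · exact (natDegree_C_mul_le _ _).trans (natDegree_prod_mul_prod_le hS _ _
      (fun _ => natDegree_numPolyRight ..) (fun _ => natDegree_denPoly ..))

lemma eval_clearedPoly (Q t : K) (x : α → K) (c : ℕ → K) (r : Finset α) (a : K) :
    (clearedPoly Q t x c r).eval a =
    ∑ S ∈ r.powerset, subsetWeight Q t x r S *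
    ((c (#S + 1) - c (#r - #S)) * ((∏ l ∈ S, (denPoly Q t (x l)).eval a) *
        ∏ l ∈ r \ S, (numPolyLeft Q t (x l)).eval a) +
      (c #S - c (#r + 1 - #S)) * ((∏ l ∈ S, (numPolyRight Q t (x l)).eval a) *
        ∏ l ∈ r \ S, (denPoly Q t (x l)).eval a)) := by
  simp [clearedPoly, eval_finsetSum, eval_prod]

/-- `∑_S (c(|S|) - c(|s| - |S|)) γ_S`. -/
def skewSum (Q t : K) (x : α → K) (c : ℕ → K) (s : Finset α) : K :=
  ∑ S ∈ s.powerset, (c #S - c (#s - #S)) * subsetWeight Q t x s S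

/-- The subsets of `insert a r` are split according to whether they contain `a`; the new point then
plays the role of the variable. -/
lemma eval_clearedPoly_eq_mul_skewSum (Q t : K) (x : α → K) (c : ℕ → K) {r : Finset α} {a : α}
    (ha : a ∉ r) (hD : ∀ l ∈ r, (denPoly Q t (x l)).eval (x a) ≠ 0) :
    (clearedPoly Q t x c r).eval (x a) =
      (∏ l ∈ r, (denPoly Q t (x l)).eval (x a)) * skewSum Q t x c (insert a r) := by
  rw [eval_clearedPoly, skewSum, sum_powerset_insert ha, ← sum_add_distrib, mul_sum]
  refine sum_congr rfl fun S hS => ?_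
  have hS := mem_powerset.1 hS
  have hcard := card_le_card hS
  rw [subsetWeight_insert_left Q t x ha hS, subsetWeight_insert_both Q t x ha hS,
    card_insert_of_notMem ha, card_insert_of_notMem (fun h => ha (hS h)),
    show #r + 1 - (#S + 1) = #r - #S by lia,
    prod_congr rfl fun l hl => eval_numPolyLeft (hD l (mem_sdiff.1 hl).1),
    prod_congr rfl fun l hl => eval_numPolyRight (hD l (hS hl)), prod_mul_distrib,
    prod_mul_distrib, ← prod_sdiff hS]
  ring

/-- The points `x_i` avoid all coincidences needed for the interpolation argument. -/
structure StronglyGeneric (Q t : K) (x : α → K) : Prop where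
  ne_zero : ∀ i, x i ≠ 0
  sub_ne : ∀ i j, i ≠ j → x i - x j ≠ 0
  twist_ne : ∀ i j, i ≠ j → Q * t⁻¹ * x i - Q⁻¹ * t * x j ≠ 0
  twist_sq_ne : ∀ i j, i ≠ j → (Q * t⁻¹) ^ 2 * x i - (Q⁻¹ * t) ^ 2 * x j ≠ 0

variable {Q t : K} {x : α → K}

omit [DecidableEq α] in
lemma StronglyGeneric.eval_denPoly_ne (hx : StronglyGeneric Q t x) {i j : α} (hij : i ≠ j) :
    (denPoly Q t (x i)).eval (x j) ≠ 0 := by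
  rw [eval_denPoly]
  exact mul_ne_zero (mul_ne_zero (hx.sub_ne _ _ hij.symm) (hx.twist_ne _ _ hij))
    (hx.twist_ne _ _ hij.symm)

/-- The pole at `X = x_a` cancels. Only subsets containing exactly one of `X` and `a` contribute;
exchanging the two keeps the cardinality, hence the coefficient, while the residues of `g(X / x_a)`
and `g(x_a / X)` are opposite. -/
lemma eval_clearedPoly_self (hx : StronglyGeneric Q t x) (c : ℕ → K) {r : Finset α} {a : α}
    (ha : a ∉ r) : (clearedPoly Q t x c (insert a r)).eval (x a) = 0 := by
  rw [eval_clearedPoly, sum_powerset_insert ha, ← sum_add_distrib]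
  refine sum_eq_zero fun S hS => ?_
  have hS := mem_powerset.1 hS
  have haS : a ∉ S := fun h => ha (hS h)
  have hD : ∀ l ∈ r, (denPoly Q t (x l)).eval (x a) ≠ 0 := fun l hl =>
    hx.eval_denPoly_ne (fun h => ha (h ▸ hl))
  have h0 : (denPoly Q t (x a)).eval (x a) = 0 := by simp [eval_denPoly]
  have hsum : (numPolyLeft Q t (x a)).eval (x a) + (numPolyRight Q t (x a)).eval (x a) = 0 := by
    simp [numPolyLeft, numPolyRight]
  rw [subsetWeight_insert_left Q t x ha hS, subsetWeight_insert_both Q t x ha hS,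
    insert_sdiff_of_notMem _ haS, insert_sdiff_insert, sdiff_insert_of_notMem ha]
  simp only [prod_insert haS, prod_insert (show a ∉ r \ S by simp [ha]), h0,
    card_insert_of_notMem ha, card_insert_of_notMem haS]
  have e1 : ∏ l ∈ r \ S, (numPolyLeft Q t (x l)).eval (x a) =
      (∏ l ∈ r \ S, pairFactor Q t (x a) (x l)) * ∏ l ∈ r \ S, (denPoly Q t (x l)).eval (x a) := by
    rw [← prod_mul_distrib]
    exact prod_congr rfl fun l hl => eval_numPolyLeft (hD l (mem_sdiff.1 hl).1)
  have e2 : ∏ l ∈ S, (numPolyRight Q t (x l)).eval (x a) =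
      (∏ l ∈ S, pairFactor Q t (x l) (x a)) * ∏ l ∈ S, (denPoly Q t (x l)).eval (x a) := by
    rw [← prod_mul_distrib]
    exact prod_congr rfl fun l hl => eval_numPolyRight (hD l (hS hl))
  rw [e1, e2, show #r + 1 + 1 - (#S + 1) = #r + 1 - #S by lia]
  linear_combination (∏ l ∈ S, pairFactor Q t (x l) (x a)) *
    (∏ l ∈ r \ S, pairFactor Q t (x a) (x l)) * subsetWeight Q t x r S * (c (#S + 1) - c (#r + 1 - #S))
    * (∏ l ∈ S, (denPoly Q t (x l)).eval (x a)) *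
    (∏ l ∈ r \ S, (denPoly Q t (x l)).eval (x a)) * hsum

/-- At `X = p² x_a` only the subsets containing `X` but not `a` survive. As `g(X / x_l) = g(x_l /
x_a)`, all of them carry the same factor `∏_l g(x_l / x_a)`, and what remains is the sum for two
points fewer with `c` shifted by one. -/
lemma eval_clearedPoly_twist (hQ : Q ≠ 0) (ht : t ≠ 0) (hx : StronglyGeneric Q t x) (c : ℕ → K)
    {r : Finset α} {a : α} (ha : a ∉ r) (ih : skewSum Q t x (fun n => c (n + 1)) r = 0) :
    (clearedPoly Q t x c (insert a r)).eval ((Q * t⁻¹) ^ 2 * x a) = 0 := by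
  have hne : ∀ l ∈ r, a ≠ l := fun l hl h => ha (h ▸ hl)
  have h0 : (denPoly Q t (x a)).eval ((Q * t⁻¹) ^ 2 * x a) = 0 := by
    rw [eval_denPoly]; field_simp; ring
  have h1 : (numPolyRight Q t (x a)).eval ((Q * t⁻¹) ^ 2 * x a) = 0 := by
    simp [numPolyRight]; field_simp; simp
  rw [eval_clearedPoly, sum_powerset_insert ha, ← sum_add_distrib]
  rw [skewSum] at ih
  refine (sum_congr rfl fun S hS => ?_).trans ((mul_sum _ _
    ((numPolyLeft Q t (x a)).eval ((Q * t⁻¹) ^ 2 * x a) * ∏ l ∈ r, (pairFactor Q t (x l) (x a) *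
      (denPoly Q t (x l)).eval ((Q * t⁻¹) ^ 2 * x a)))).symm.trans (by rw [ih, mul_zero]))
  have hS := mem_powerset.1 hS
  have haS : a ∉ S := fun h => ha (hS h)
  have hcard := card_le_card hS
  rw [subsetWeight_insert_left Q t x ha hS, subsetWeight_insert_both Q t x ha hS,
    insert_sdiff_of_notMem _ haS, insert_sdiff_insert, sdiff_insert_of_notMem ha]
  simp only [prod_insert haS, prod_insert (show a ∉ r \ S by simp [ha]), h0, h1,
    card_insert_of_notMem ha, card_insert_of_notMem haS]
  rw [← prod_sdiff hS, prod_congr rfl fun l hl => eval_numPolyLeft_mul hQ ht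
    (hx.sub_ne _ _ (hne l (mem_sdiff.1 hl).1)) (hx.twist_ne _ _ (hne l (mem_sdiff.1 hl).1)),
    show #r + 1 - #S = #r - #S + 1 by lia, prod_mul_distrib, prod_mul_distrib]
  ring

/-- Mirror image of the preceding case: now the subsets containing `a` but not `X` survive. -/
lemma eval_clearedPoly_twist_inv (hQ : Q ≠ 0) (ht : t ≠ 0) (hx : StronglyGeneric Q t x) (c : ℕ → K)
    {r : Finset α} {a : α} (ha : a ∉ r) (ih : skewSum Q t x (fun n => c (n + 1)) r = 0) :
    (clearedPoly Q t x c (insert a r)).eval ((Q⁻¹ * t) ^ 2 * x a) = 0 := by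
  have hne : ∀ l ∈ r, a ≠ l := fun l hl h => ha (h ▸ hl)
  have h0 : (denPoly Q t (x a)).eval ((Q⁻¹ * t) ^ 2 * x a) = 0 := by
    rw [eval_denPoly]; field_simp; ring
  have h1 : (numPolyLeft Q t (x a)).eval ((Q⁻¹ * t) ^ 2 * x a) = 0 := by
    simp [numPolyLeft]; field_simp; simp
  rw [eval_clearedPoly, sum_powerset_insert ha, ← sum_add_distrib]
  rw [skewSum] at ih
  refine (sum_congr rfl fun S hS => ?_).trans ((mul_sum _ _
    ((numPolyRight Q t (x a)).eval ((Q⁻¹ * t) ^ 2 * x a) * ∏ l ∈ r, (pairFactor Q t (x a) (x l) *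
      (denPoly Q t (x l)).eval ((Q⁻¹ * t) ^ 2 * x a)))).symm.trans (by rw [ih, mul_zero]))
  have hS := mem_powerset.1 hS
  have haS : a ∉ S := fun h => ha (hS h)
  have hcard := card_le_card hS
  rw [subsetWeight_insert_left Q t x ha hS, subsetWeight_insert_both Q t x ha hS,
    insert_sdiff_of_notMem _ haS, insert_sdiff_insert, sdiff_insert_of_notMem ha]
  simp only [prod_insert haS, prod_insert (show a ∉ r \ S by simp [ha]), h0, h1,
    card_insert_of_notMem ha, card_insert_of_notMem haS]
  rw [← prod_sdiff hS, prod_congr rfl fun l hl => eval_numPolyRight_mul hQ ht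
    (hx.sub_ne _ _ (hne l (hS hl)).symm) (hx.twist_ne _ _ (hne l (hS hl)).symm),
    show #r + 1 + 1 - (#S + 1) = #r - #S + 1 by lia, prod_mul_distrib, prod_mul_distrib]
  ring

/-- Since `g(0) = g(∞) = 1`, at `X = 0` the variable decouples and leaves the sums over `r` for `c`
and for its shift. -/
lemma eval_clearedPoly_zero (hQ : Q ≠ 0) (ht : t ≠ 0) (c : ℕ → K) {r : Finset α}
    (ih : ∀ c : ℕ → K, skewSum Q t x c r = 0) :
    (clearedPoly Q t x c r).eval 0 = 0 := by
  have hD (y : K) : (denPoly Q t y).eval 0 = y ^ 3 := by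
    rw [eval_denPoly]; field_simp; ring
  have hL (y : K) : (numPolyLeft Q t y).eval 0 = y ^ 3 := by
    simp [numPolyLeft]; field_simp
  have hR (y : K) : (numPolyRight Q t y).eval 0 = y ^ 3 := by
    simp [numPolyRight]; field_simp
  have h1 := ih c
  have h2 := ih fun n => c (n + 1)
  rw [skewSum] at h1 h2
  rw [eval_clearedPoly]
  simp only [hD, hL, hR]
  refine (sum_congr rfl fun S hS => ?_).trans (((mul_sum _ _ (∏ l ∈ r, x l ^ 3)).symm.trans
    (congrArg _ (sum_add_distrib (f := fun S => (c (#S + 1) - c (#r - #S + 1)) *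
      subsetWeight Q t x r S) (g := fun S => (c #S - c (#r - #S)) *
      subsetWeight Q t x r S)))).trans (by rw [h1, h2]; simp))
  have hS := mem_powerset.1 hS
  have hcard := card_le_card hS
  rw [← prod_sdiff hS, show #r + 1 - #S = #r - #S + 1 by lia]
  ring

/-- Trigonometric case of Ruijsenaars' identity, at strongly generic points. -/
theorem skewSum_eq_zero_of_stronglyGeneric (hQ : Q ≠ 0) (ht : t ≠ 0)
    (h2 : (Q * t⁻¹) ^ 2 ≠ 1) (h4 : (Q * t⁻¹) ^ 4 ≠ 1) (hx : StronglyGeneric Q t x) (s : Finset α) :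
    ∀ c : ℕ → K, skewSum Q t x c s = 0 := by
  induction s using Finset.strongInduction with
  | H s ih =>
  intro c
  rcases s.eq_empty_or_nonempty with rfl | ⟨i, hi⟩
  · simp [skewSum]
  obtain ⟨r, hir, rfl⟩ : ∃ r, i ∉ r ∧ insert i r = s := ⟨s.erase i, by simp, insert_erase hi⟩
  have hD : ∀ l ∈ r, (denPoly Q t (x l)).eval (x i) ≠ 0 := fun l hl =>
    hx.eval_denPoly_ne (fun h => hir (h ▸ hl))
  have key := eval_clearedPoly_eq_mul_skewSum Q t x c hir hD
  suffices hN : clearedPoly Q t x c r = 0 by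
    rw [hN, eval_zero, eq_comm, mul_eq_zero] at key
    exact key.resolve_left (prod_ne_zero_iff.2 hD)
  have hp : Q * t⁻¹ ≠ 0 := mul_ne_zero hQ (inv_ne_zero ht)
  have hpi : Q⁻¹ * t = (Q * t⁻¹)⁻¹ := by rw [mul_inv, inv_inv]
  -- The nodes are `0` and `x_a`, `p² x_a`, `p⁻² x_a` for `a ∈ r`: one more than the degree bound `3
  -- * #r`. Strong genericity, `p² ≠ 1` and `p⁴ ≠ 1` make them distinct.
  let f : Option (r × Fin 3) → K := fun o => o.elim 0 fun ae =>
    ![1, (Q * t⁻¹) ^ 2, (Q⁻¹ * t) ^ 2] ae.2 * x ae.1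
  have hrs : r ⊂ insert i r := ssubset_insert hir
  refine eq_zero_of_natDegree_lt_card_of_eval_eq_zero _ (f := f) ?_ ?_ ?_
  · have hfne : ∀ e : Fin 3, ![1, (Q * t⁻¹) ^ 2, (Q⁻¹ * t) ^ 2] e ≠ 0 := by
      intro e
      fin_cases e <;> simp [hQ, ht]
    rintro (_ | ⟨a, e⟩) (_ | ⟨a', e'⟩) h
    · rfl
    · exact absurd h.symm (mul_ne_zero (hfne _) (hx.ne_zero _))
    · exact absurd h (mul_ne_zero (hfne _) (hx.ne_zero _))
    · simp only [f, Option.elim] at h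
      by_cases haa : a = a'
      · subst haa
        have h := mul_right_cancel₀ (hx.ne_zero _) h
        congr
        set p := Q * t⁻¹
        rw [hpi] at h
        have hp2 : p ^ 2 ≠ 0 := pow_ne_zero _ hp
        fin_cases e <;> fin_cases e' <;> simp at h ⊢
        · exact h2 h.symm
        · rcases h with h | h <;> exact h2 (by rw [h]; ring)
        · rcases h with h | h <;> exact h2 (by rw [h]; ring)
        · exact h4 (by linear_combination mul_inv_cancel₀ hp2 + p ^ 2 * h)
        · rcases h with h | h <;> exact h2 (by rw [h]; ring)
        · exact h4 (by linear_combination mul_inv_cancel₀ hp2 - p ^ 2 * h)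
      · exfalso
        have hne : (a : α) ≠ a' := fun h => haa (Subtype.ext h)
        have s1 := hx.sub_ne _ _ hne
        have t1 := hx.twist_ne _ _ hne
        have t2 := hx.twist_ne _ _ hne.symm
        have q1 := hx.twist_sq_ne _ _ hne
        have q2 := hx.twist_sq_ne _ _ hne.symm
        rw [hpi] at t1 t2 q1 q2 h
        set p := Q * t⁻¹
        fin_cases e <;> fin_cases e' <;> simp at h
        · exact s1 (by rw [h, sub_self])
        · exact t2 (by rw [h]; field_simp; ring)
        · exact t1 (by rw [h]; field_simp; ring)
        · exact t1 (by rw [← h]; field_simp; ring)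
        · exact s1 (sub_eq_zero.2 (h.resolve_right hp))
        · exact q1 (by rw [h, ← inv_pow, sub_self])
        · exact t2 (by rw [← h]; field_simp; ring)
        · exact q2 (by rw [← h, ← inv_pow, sub_self])
        · exact s1 (sub_eq_zero.2 (h.resolve_right hp))
  · rintro (_ | ⟨a, e⟩)
    · exact eval_clearedPoly_zero hQ ht c (ih r hrs)
    · obtain ⟨r', hr', hr⟩ : ∃ r', (a : α) ∉ r' ∧ insert (a : α) r' = r :=
        ⟨r.erase a, by simp, insert_erase a.2⟩
      have ih' := ih r' ((hr ▸ ssubset_insert hr').trans hrs)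
      simp only [f, Option.elim]
      have E0 := eval_clearedPoly_self hx c hr'
      have E1 := eval_clearedPoly_twist hQ ht hx c hr' (ih' _)
      have E2 := eval_clearedPoly_twist_inv hQ ht hx c hr' (ih' _)
      rw [hr] at E0 E1 E2
      fin_cases e
      · simpa using E0
      · exact E1
      · exact E2
  · refine (natDegree_clearedPoly Q t x c r).trans_lt ?_
    simp [mul_comm]

end SourceIdentity

/-! ### From strongly generic points to general position -/

section GeneralPosition

open Finset Filter Topology

/-- Moving the points apart along lines of pairwise different slopes. -/
def spread {m : ℕ} (x : Fin m → ℂ) (s : ℂ) (i : Fin m) : ℂ := x i * (1 + (i : ℕ) * s)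

lemma continuous_spread {m : ℕ} (x : Fin m → ℂ) (i : Fin m) : Continuous fun s => spread x s i := by
  unfold spread; fun_prop

lemma spread_zero {m : ℕ} (x : Fin m → ℂ) : spread x 0 = x := by
  ext; simp [spread]

/-- If the difference vanishes at `s = 0`, it is linear in `s` with slope `A * x i * (i - j)`, which
is nonzero. -/
lemma eventually_spread_sub_ne {m : ℕ} {x : Fin m → ℂ} (hx : ∀ i, x i ≠ 0) {i j : Fin m}
    (hij : i ≠ j) {A : ℂ} (hA : A ≠ 0) (B : ℂ) :
    ∀ᶠ s in 𝓝[≠] (0 : ℂ), A * spread x s i - B * spread x s j ≠ 0 := by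
  by_cases h0 : A * x i - B * x j = 0
  · filter_upwards [self_mem_nhdsWithin] with s hs h
    have : A * x i * ((i : ℕ) - (j : ℕ) : ℂ) * s = 0 := by
      unfold spread at h
      linear_combination h - h0 * (1 + (j : ℕ) * s)
    have hne : ((i : ℕ) - (j : ℕ) : ℂ) ≠ 0 := by
      rw [sub_ne_zero]
      exact_mod_cast Fin.val_injective.ne hij
    exact mul_ne_zero (mul_ne_zero (mul_ne_zero hA (hx i)) hne) hs this
  · have hc : Continuous fun s => A * spread x s i - B * spread x s j :=
      ((continuous_spread x i).const_mul A).sub ((continuous_spread x j).const_mul B)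
    refine (hc.tendsto 0).eventually_ne ?_ |>.filter_mono nhdsWithin_le_nhds
    simpa [spread] using h0

lemma eventually_stronglyGeneric_spread {Q t : ℂ} (hQ : Q ≠ 0) (ht : t ≠ 0) {m : ℕ}
    {x : Fin m → ℂ} (hx : ∀ i, x i ≠ 0) :
    ∀ᶠ s in 𝓝[≠] (0 : ℂ), StronglyGeneric Q t (spread x s) := by
  have hp : Q * t⁻¹ ≠ 0 := mul_ne_zero hQ (inv_ne_zero ht)
  have key (A B : ℂ) (hA : A ≠ 0) : ∀ᶠ s in 𝓝[≠] (0 : ℂ), ∀ i j, i ≠ j →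
      A * spread x s i - B * spread x s j ≠ 0 := by
    simp only [eventually_all]
    exact fun i j hij => eventually_spread_sub_ne hx hij hA B
  have h0 : ∀ᶠ s in 𝓝[≠] (0 : ℂ), ∀ i, spread x s i ≠ 0 := by
    rw [eventually_all]
    intro i
    refine ((continuous_spread x i).tendsto 0).eventually_ne ?_ |>.filter_mono nhdsWithin_le_nhds
    simpa [spread] using hx i
  filter_upwards [h0, key 1 1 one_ne_zero, key _ (Q⁻¹ * t) hp,
    key _ ((Q⁻¹ * t) ^ 2) (pow_ne_zero 2 hp)] with s h0 h1 h2 h3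
  exact ⟨h0, fun i j hij => by simpa using h1 i j hij, h2, h3⟩

lemma stringCoeff_eq_subsetWeight {Q t : ℂ} {m : ℕ} {x : Fin m → ℂ} (hx : ∀ i, x i ≠ 0)
    (S : Finset (Fin m)) : stringCoeff Q t x S = subsetWeight Q t x univ S := by
  unfold stringCoeff subsetWeight
  refine prod_congr rfl fun i _ => prod_congr (compl_eq_univ_sdiff S) fun l _ => ?_
  have hl := hx l
  rw [pairFactor, ← mul_div_mul_right _ _ (mul_ne_zero hl hl)]
  congr 1 <;> field_simp

/-- Trigonometric case of Ruijsenaars' identity: the sums of the coefficients of a string over the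
subsets of a given size are invariant under passing to the complementary size. -/
theorem sum_stringCoeff_reverse {Q t : ℂ} (hQ : Q ≠ 0) (ht : t ≠ 0)
    (h2 : (Q * t⁻¹) ^ 2 ≠ 1) (h4 : (Q * t⁻¹) ^ 4 ≠ 1) {m : ℕ} {x : Fin m → ℂ}
    (hx : InGeneralPosition Q t x) (c : ℕ → ℂ) :
    ∑ S : Finset (Fin m), c #S * stringCoeff Q t x S =
      ∑ S : Finset (Fin m), c (m - #S) * stringCoeff Q t x S := by
  -- General position does not exclude `p² x_i = p⁻² x_j`, so the points are perturbed; the identity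
  -- then passes to the limit because no denominator vanishes at `x`.
  have hev : ∀ᶠ s in 𝓝[≠] (0 : ℂ), skewSum Q t (spread x s) c univ = 0 := by
    filter_upwards [eventually_stronglyGeneric_spread hQ ht hx.1] with s hs
    exact skewSum_eq_zero_of_stronglyGeneric hQ ht h2 h4 hs _ c
  have hlim : Tendsto (fun s => skewSum Q t (spread x s) c univ) (𝓝[≠] 0)
      (𝓝 (skewSum Q t x c univ)) := by
    refine Tendsto.mono_left ?_ nhdsWithin_le_nhds
    refine tendsto_finsetSum _ fun S _ => Tendsto.const_mul _ <| tendsto_finsetProd _ fun i hi =>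
      tendsto_finsetProd _ fun l hl => ?_
    have hil : i ≠ l := fun h => (mem_sdiff.1 hl).2 (h ▸ hi)
    have hl0 := hx.1 l
    obtain ⟨d1, d2⟩ := hx.2 i l hil
    have ti : Tendsto (fun s => spread x s i) (𝓝 0) (𝓝 (x i)) := by
      simpa [spread_zero] using (continuous_spread x i).tendsto 0
    have tl : Tendsto (fun s => spread x s l) (𝓝 0) (𝓝 (x l)) := by
      simpa [spread_zero] using (continuous_spread x l).tendsto 0
    refine Tendsto.div (((tl.const_mul _).sub (ti.const_mul _)).mul
      ((tl.const_mul _).sub (ti.const_mul _)))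
      ((tl.sub ti).mul ((tl.const_mul _).sub (ti.const_mul _))) (mul_ne_zero ?_ ?_)
    · intro h
      exact d1 (by rw [← sub_eq_zero.1 h, div_self hl0, sub_self])
    · intro h
      apply d2
      have : (Q * t⁻¹ - Q⁻¹ * t * (x i / x l)) * x l = 0 := by
        rw [← h]; field_simp
      exact (mul_eq_zero.1 this).resolve_right hl0
  have h0 : skewSum Q t x c univ = 0 :=
    tendsto_nhds_unique hlim (tendsto_const_nhds.congr' (hev.mono fun _ h => h.symm))
  rw [← sub_eq_zero, ← sum_sub_distrib, ← h0, skewSum, powerset_univ]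
  refine sum_congr rfl fun S _ => ?_
  rw [stringCoeff_eq_subsetWeight hx.1, card_univ, Fintype.card_fin]
  ring

end GeneralPosition

/-! ### Action of the zeroth mode on the vacuum -/

section VacuumMode

variable {ι V V' : Type*} [Fintype ι] [DecidableEq ι] [AddCommGroup V] [Module ℂ V]
  [AddCommGroup V'] [Module ℂ V'] {P : RootPairing ι ℂ V V'} [P.IsCrystallographic]
  {b : P.Base} (ħ β : ℂ)

lemma aMode_apply_one_of_pos (μ : V) (i : b.support) (n : ℕ) :
    aMode b ħ β μ i ((n + 1 : ℕ) : ℤ) 1 = 0 := by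
  change aMode b ħ β μ i (Int.ofNat (n + 1)) 1 = 0
  simp only [aMode, LinearMap.sum_apply, LinearMap.smul_apply]
  refine Finset.sum_eq_zero fun j _ => ?_
  rw [Derivation.coeFn_coe, Derivation.map_one_eq_zero, smul_zero]

lemma oscMode_apply_one_of_pos (μ : V) (u : YMonomial b) (n : ℕ) :
    oscMode ħ β μ u ((n + 1 : ℕ) : ℤ) 1 = 0 := by
  unfold oscMode yMode
  rw [Finsupp.sum, LinearMap.sum_apply]
  refine Finset.sum_eq_zero fun k _ => ?_
  rw [LinearMap.smul_apply, LinearMap.sum_apply,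
    Finset.sum_eq_zero fun j _ => by rw [LinearMap.smul_apply, aMode_apply_one_of_pos, smul_zero],
    smul_zero]

lemma expCoeff_zero {E : Type*} [AddCommGroup E] [Module ℂ E] (A : ℕ → Module.End ℂ E) :
    expCoeff A 0 = 1 := by
  simp [expCoeff]

/-- In each positive power the rightmost factor acts first; its constant coefficient is zero and its
other coefficients kill `v`. -/
lemma expCoeff_succ_apply_eq_zero {E : Type*} [AddCommGroup E] [Module ℂ E]
    (A : ℕ → Module.End ℂ E) {v : E} (hv : ∀ n, A (n + 1) v = 0) (n : ℕ) :
    expCoeff A (n + 1) v = 0 := by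
  rw [expCoeff, LinearMap.sum_apply]
  refine Finset.sum_eq_zero fun r _ => ?_
  rw [LinearMap.smul_apply]
  rcases r with _ | r
  · simp [PowerSeries.coeff_one]
  · rw [pow_succ, PowerSeries.coeff_mul, LinearMap.sum_apply, Finset.sum_eq_zero, smul_zero]
    rintro ⟨k, l⟩ _
    rw [Module.End.mul_apply, PowerSeries.coeff_mk]
    rcases l with _ | l <;> simp [hv]

lemma monomialMode_zero_one (μ : V) (u : YMonomial b) :
    monomialMode ħ β μ u 0 1 = zeroModePart ħ β μ u • (1 : Fock b) := by
  unfold monomialMode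
  congr 1
  rw [finsum_eq_single _ 0]
  · simp [expCoeff_zero]
  · intro k hk
    obtain ⟨k, rfl⟩ := Nat.exists_eq_succ_of_ne_zero hk
    rw [expCoeff_succ_apply_eq_zero _ fun n => oscMode_apply_one_of_pos ħ β μ u n]
    simp

lemma fieldMode_zero_one (μ : V) (T : YField b) :
    fieldMode ħ β μ T 0 1 = (T.sum fun u c => c * zeroModePart ħ β μ u) • (1 : Fock b) := by
  simp only [fieldMode, monomialMode_zero_one, smul_smul, Finsupp.sum, Finset.sum_smul]

lemma highestWeight_eq_sum (μ : V) (T : YField b) :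
    highestWeight ħ β T μ = T.sum fun u c => c * zeroModePart ħ β μ u := by
  rw [highestWeight, fieldMode_zero_one]
  simp

end VacuumMode

/-! ### A height function positive on the simple roots -/

section PositiveCombination

variable {ι V V' : Type*} [Fintype ι] [AddCommGroup V] [Module ℂ V]
  [AddCommGroup V'] [Module ℂ V'] {P : RootPairing ι ℂ V V'} [P.IsCrystallographic] [P.IsReduced]

-- This is `⟨2ρ, α_j^∨⟩ = 2`: the reflection `s_j` permutes the positive roots other than `α_j` and
-- changes the sign of their pairing with `α_j^∨`, so only `α_j` contributes.
open Classical in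
lemma sum_pos_pairingIn (b : P.Base) (j : b.support) :
    ∑ k : ι with b.IsPos k, P.pairingIn ℤ k j = 2 := by
  have hj : (j : ι) ∈ Finset.univ.filter fun k => b.IsPos k := by
    simpa using RootPairing.Base.isPos_of_mem_support j.2
  have hneg : ¬ b.IsPos (P.reflectionPerm j j) :=
    mt (RootPairing.Base.IsPos.neg_iff_not b (j : ι)).1
      (not_not.2 (RootPairing.Base.isPos_of_mem_support j.2))
  have hmem : ∀ k ∈ (Finset.univ.filter fun k => b.IsPos k).erase (j : ι),
      P.reflectionPerm j k ∈ (Finset.univ.filter fun k => b.IsPos k).erase (j : ι) := by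
    intro k hk
    simp only [Finset.mem_erase, Finset.mem_filter, Finset.mem_univ, true_and] at hk ⊢
    refine ⟨fun h => hneg ?_, hk.2.reflectionPerm j.2 hk.1⟩
    have : k = P.reflectionPerm j j := by
      rw [← P.reflectionPerm_self j k, h]
    exact this ▸ hk.2
  have h0 : ∑ k ∈ (Finset.univ.filter fun k => b.IsPos k).erase (j : ι), P.pairingIn ℤ k j =
      ∑ k ∈ (Finset.univ.filter fun k => b.IsPos k).erase (j : ι), -P.pairingIn ℤ k j := by
    refine Finset.sum_nbij' (P.reflectionPerm j) (P.reflectionPerm j) hmem hmem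
      (by simp) (by simp) fun k _ => ?_
    rw [← P.pairingIn_reflectionPerm, P.pairingIn_reflectionPerm_self_right, neg_neg]
  rw [Finset.sum_neg_distrib] at h0
  rw [← Finset.add_sum_erase _ _ hj, P.pairingIn_same]
  lia

omit [Fintype ι] [P.IsCrystallographic] [P.IsReduced] in
lemma exists_root_eq_sum_nat_of_isPos {b : P.Base} {k : ι} (hk : b.IsPos k) :
    ∃ f : ι → ℕ, P.root k = ∑ i ∈ b.support, f i • P.root i := by
  obtain ⟨f, -, h | h⟩ := b.exists_root_eq_sum_nat_or_neg k
  · exact ⟨f, h⟩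
  · exfalso
    have h' : P.root k = ∑ i ∈ b.support, (fun i => -(f i : ℤ)) i • P.root i := by
      simpa using h
    rw [RootPairing.Base.isPos_iff, RootPairing.Base.height_eq_sum h'] at hk
    simp only [Finset.sum_neg_distrib] at hk
    have : 0 ≤ ∑ i ∈ b.support, (f i : ℤ) := Finset.sum_nonneg fun _ _ => by positivity
    lia

/-- The coefficients of `2ρ` in the simple roots work. -/
lemma exists_nat_sum_pairingIn_pos (b : P.Base) :
    ∃ c : b.support → ℕ, ∀ j : b.support, 0 < ∑ i, (c i : ℤ) * P.pairingIn ℤ i j := by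
  classical
  choose! f hf using fun k (hk : b.IsPos k) => exists_root_eq_sum_nat_of_isPos hk
  refine ⟨fun i => ∑ k : ι with b.IsPos k, f k i, fun j => ?_⟩
  have : ∀ k, b.IsPos k → P.pairingIn ℤ k j = ∑ i : b.support, (f k i : ℤ) * P.pairingIn ℤ i j := by
    intro k hk
    apply (algebraMap ℤ ℂ).injective_int
    rw [P.algebraMap_pairingIn, ← P.root_coroot'_eq_pairing, hf k hk, map_sum,
      ← Finset.sum_coe_sort]
    simp [← P.algebraMap_pairingIn ℤ]
  have h2 := sum_pos_pairingIn b j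
  rw [Finset.sum_congr rfl fun k hk => this k (by simpa using hk), Finset.sum_comm] at h2
  simp only [Nat.cast_sum, Finset.sum_mul]
  lia

/-- The dual root system gives the coefficients of `2ρ^∨`, which will define the height. -/
lemma exists_nat_sum_pairingIn_pos' (b : P.Base) :
    ∃ c : b.support → ℕ, ∀ j : b.support, 0 < ∑ i, (c i : ℤ) * P.pairingIn ℤ j i := by
  obtain ⟨c, hc⟩ := exists_nat_sum_pairingIn_pos (P := P.flip) b.flip
  refine ⟨c, fun j => (hc j).trans_eq (Finset.sum_congr rfl fun i _ => ?_)⟩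
  congr 1

end PositiveCombination

/-! ### Fundamental weights and weights of monomials -/

section Weights

variable {ι V V' : Type*} [Fintype ι] [DecidableEq ι] [AddCommGroup V] [Module ℂ V]
  [AddCommGroup V'] [Module ℂ V'] {P : RootPairing ι ℂ V V'} [P.IsRootSystem]

-- The roots span, so an element of the group is determined by its permutation of the finitely many
-- roots.
omit [DecidableEq ι] in
instance finite_weylGroup : Finite P.weylGroup := by
  classical
  refine Finite.of_injective (fun w : P.weylGroup => P.weylGroupToPerm w) fun w w' h => ?_
  have hmap : RootPairing.Equiv.weightHom P w = RootPairing.Equiv.weightHom P w' := by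
    apply LinearEquiv.toLinearMap_injective
    refine LinearMap.ext_on_range (v := P.root)
      RootPairing.IsRootSystem.span_root_eq_top fun i => ?_
    have h1 := P.weylGroup_apply_root w i
    have h2 := P.weylGroup_apply_root w' i
    change P.weylGroupToPerm w = P.weylGroupToPerm w' at h
    rw [h, ← h2] at h1
    exact h1
  exact Subtype.ext (RootPairing.Equiv.weightHom_injective P hmap)

/-- The basis of `V` dual to the simple coroots. -/
def fundBasis (b : P.Base) : Module.Basis b.support ℂ V :=
  b.toCoweightBasis.dualBasis.map P.toPerfPair.symm

lemma fundBasis_repr (b : P.Base) (v : V) (i : b.support) :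
    (fundBasis b).repr v i = P.coroot' i v := by
  simp [fundBasis]

variable [P.IsCrystallographic]

omit [P.IsRootSystem] in
lemma cast_incidence (b : P.Base) (i j : b.support) :
    (incidence b i j : ℂ) = (if i = j then 2 else 0) - P.pairing j i := by
  have h : 0 ≤ (if i = j then 2 else 0) - cartan b i j := by
    unfold cartan
    split_ifs with hij
    · subst hij; simp
    · have := b.cartanMatrix_le_zero_of_ne j i (Ne.symm hij)
      change P.pairingIn ℤ j i ≤ 0 at this
      lia
  have h2 : ((incidence b i j : ℤ) : ℂ) = (((if i = j then 2 else 0) - cartan b i j : ℤ) : ℂ) := by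
    rw [incidence, Int.toNat_of_nonneg h]
  rw [Int.cast_natCast] at h2
  rw [h2, ← P.algebraMap_pairingIn ℤ]
  push_cast
  rfl

omit [Fintype ι] [DecidableEq ι] [P.IsRootSystem] in
lemma cast_cartanMatrix (b : P.Base) (i j : b.support) :
    (b.cartanMatrix i j : ℂ) = P.pairing i j :=
  P.algebraMap_pairingIn ℤ i j

omit [P.IsRootSystem] in
lemma deformedCartan_one_one (b : P.Base) :
    deformedCartan b 1 1 = ((b.cartanMatrix).map (Int.cast : ℤ → ℂ)).transpose := by
  ext i j
  simp only [deformedCartan, qInt, Matrix.of_apply, Matrix.transpose_apply, Matrix.map_apply,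
    one_zpow, Finset.sum_const, Finset.card_range, nsmul_eq_mul, mul_one, cast_incidence, inv_one,
    cast_cartanMatrix]
  split_ifs <;> ring

lemma fundWeight_eq (b : P.Base) (i : b.support) : fundWeight b i = fundBasis b i := by
  have hdet : IsUnit (deformedCartan b 1 1).det := by
    rw [deformedCartan_one_one, Matrix.det_transpose, isUnit_iff_ne_zero]
    have h := Matrix.nondegenerate_iff_det_ne_zero.1 b.cartanMatrix_nondegenerate
    have h' := (Int.castRingHom ℂ).map_det b.cartanMatrix
    rw [RingHom.mapMatrix_apply] at h'
    exact fun h0 => h (Int.cast_injective (α := ℂ) (by rw [Int.cast_zero, ← h0]; exact h'))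
  refine (fundBasis b).repr.injective (Finsupp.ext fun k => ?_)
  rw [fundBasis_repr, Module.Basis.repr_self, fundWeight, map_sum]
  have h := congrFun (congrFun (Matrix.mul_nonsing_inv _ hdet) k) i
  rw [Matrix.mul_apply, Matrix.one_apply] at h
  rw [Finsupp.single_apply]
  simp only [eq_comm (a := i)]
  rw [← h]
  refine Finset.sum_congr rfl fun j _ => ?_
  rw [map_smul, smul_eq_mul, mul_comm, P.root_coroot'_eq_pairing]
  congr 1
  rw [deformedCartan_one_one, Matrix.transpose_apply, Matrix.map_apply,
    cast_cartanMatrix]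

lemma coroot'_fundWeight (b : P.Base) (i j : b.support) :
    P.coroot' j (fundWeight b i) = if i = j then 1 else 0 := by
  rw [fundWeight_eq, ← fundBasis_repr, Module.Basis.repr_self, Finsupp.single_apply]

lemma sum_coroot'_smul_fundWeight (b : P.Base) (v : V) :
    ∑ i : b.support, P.coroot' i v • fundWeight b i = v := by
  simp only [fundWeight_eq, ← fundBasis_repr, Module.Basis.sum_repr]

/-- The weight of a normal ordered monomial. -/
def wt (b : P.Base) : YMonomial b →+ V :=
  Finsupp.liftAddHom fun k => zmultiplesHom V (fundWeight b k.1)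

omit [P.IsRootSystem] in
lemma wt_yMon (b : P.Base) (i : b.support) (a c : ℤ) : wt b (yMon i a c) = fundWeight b i := by
  simp [wt, yMon]

/-- The factors of `A_j` spell out the expansion of `α_j` in fundamental weights: `2 ω_j` from the
two `Y_j`, and `-I_{kj} = ⟨α_j, α_k^∨⟩` times `ω_k` for `k ≠ j`. -/
lemma wt_aMon (b : P.Base) (j : b.support) (a c : ℤ) : wt b (aMon j a c) = P.root j := by
  rw [aMon, map_sub, map_add, map_sum]
  simp only [map_sum, wt_yMon, Finset.sum_const, Finset.card_range]
  conv_rhs => rw [← sum_coroot'_smul_fundWeight b (P.root j),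
    ← Finset.add_sum_erase _ _ (Finset.mem_univ j)]
  rw [sub_eq_add_neg, ← Finset.sum_neg_distrib, P.root_coroot'_eq_pairing, P.pairing_same, two_smul]
  congr 1
  refine Finset.sum_congr rfl fun k hk => ?_
  rw [← Nat.cast_smul_eq_nsmul ℂ, cast_incidence, if_neg (Finset.ne_of_mem_erase hk),
    P.root_coroot'_eq_pairing]
  simp

lemma coroot'_wt_eq_zero {b : P.Base} {j : b.support} {u : YMonomial b}
    (hu : ∀ a c, u (j, a, c) = 0) : P.coroot' j (wt b u) = 0 := by
  simp only [wt, Finsupp.liftAddHom_apply, Finsupp.sum, map_sum]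
  refine Finset.sum_eq_zero fun k hk => ?_
  rw [zmultiplesHom_apply, map_zsmul, coroot'_fundWeight, if_neg, smul_zero]
  rintro rfl
  exact Finsupp.mem_support_iff.1 hk (hu _ _)

lemma wt_stringMon (b : P.Base) (j : b.support) (u : YMonomial b) {m : ℕ} (p : Fin m → ℤ × ℤ)
    (S : Finset (Fin m)) :
    wt b (stringMon j u p S) = wt b u + (m : ℂ) • fundWeight b j - (S.card : ℂ) • P.root j := by
  simp only [stringMon, map_sub, map_add, map_sum, wt_yMon, wt_aMon, Finset.sum_const,
    Finset.card_univ, Fintype.card_fin, Nat.cast_smul_eq_nsmul]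

/-- `s_j` fixes the weight of `U` and sends `m ω_j - k α_j` to `m ω_j - (m - k) α_j`. -/
lemma reflection_wt_stringMon {b : P.Base} {j : b.support} {u : YMonomial b}
    (hu : ∀ a c, u (j, a, c) = 0) {m : ℕ} (p : Fin m → ℤ × ℤ) (S : Finset (Fin m)) :
    P.reflection j (wt b (stringMon j u p S)) =
      wt b u + (m : ℂ) • fundWeight b j - ((m - S.card : ℕ) : ℂ) • P.root j := by
  have hS : S.card ≤ m := by simpa using Finset.card_le_univ S
  rw [P.reflection_apply, wt_stringMon, map_sub, map_add, map_smul, map_smul, coroot'_wt_eq_zero hu,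
    coroot'_fundWeight, P.root_coroot'_eq_pairing, P.pairing_same, Nat.cast_sub hS]
  simp only [if_true, smul_eq_mul]
  module

end Weights

/-! ### The normalized form and its relation to coroots -/

section InvariantForm

variable {ι V V' : Type*} [Fintype ι] [AddCommGroup V] [Module ℂ V]
  [AddCommGroup V'] [Module ℂ V'] (P : RootPairing ι ℂ V V') [P.IsCrystallographic]

/-- The invariant form as a bundled bilinear form. -/
def formHom : LinearMap.BilinForm ℂ V := (2 / (longSq P : ℂ)) • P.RootForm

lemma form_eq (x y : V) : form P x y = formHom P x y := rfl

lemma form_comm (x y : V) : form P x y = form P y x := by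
  unfold form
  rw [P.rootForm_symmetric.eq x y |>.symm]
  rfl

lemma form_weylGroup_smul (w : P.weylGroup) (x y : V) : form P (w • x) (w • y) = form P x y :=
  congrArg _ (RootPairing.InvariantForm.apply_weylGroup_smul P (B := P.toInvariantForm) w x y)

lemma cast_rootSq (i : ι) : (rootSq P i : ℂ) = P.RootForm (P.root i) (P.root i) := by
  rw [P.rootForm_root_self, rootSq]
  push_cast
  refine Finset.sum_congr rfl fun k _ => ?_
  rw [← P.algebraMap_pairingIn ℤ, ← pow_two, Nat.cast_natAbs, algebraMap_int_eq, eq_intCast,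
    ← Int.cast_pow, sq_abs, Int.cast_pow]

lemma rootSq_pos (i : ι) : 0 < rootSq P i := by
  rw [Nat.pos_iff_ne_zero, ← Nat.cast_ne_zero (R := ℂ), cast_rootSq]
  exact RootPairing.IsAnisotropic.rootForm_root_ne_zero i

lemma longSq_pos (i : ι) : 0 < longSq P :=
  (rootSq_pos P i).trans_le (Finset.le_sup (f := rootSq P) (Finset.mem_univ i))

lemma form_root_root (i : ι) : form P (P.root i) (P.root i) = 2 / longSq P * rootSq P i := by
  rw [form, cast_rootSq]

lemma form_root_root_ne_zero (i : ι) : form P (P.root i) (P.root i) ≠ 0 := by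
  have h1 : (rootSq P i : ℂ) ≠ 0 := Nat.cast_ne_zero.2 (rootSq_pos P i).ne'
  have h2 : (longSq P : ℂ) ≠ 0 := Nat.cast_ne_zero.2 (longSq_pos P i).ne'
  rw [form_root_root]
  exact mul_ne_zero (div_ne_zero two_ne_zero h2) h1

/-- Invariance under `s_i` gives `(s_i x, α_i) = -(x, α_i)`; expanding `s_i x` expresses `2 (x,
α_i)` through `(α_i, α_i)`. -/
lemma form_corootVec (x : V) (i : ι) : form P x (corootVec P i) = P.coroot' i x := by
  have h0 := form_root_root_ne_zero P i
  have h : P.RootForm (P.reflection i x) (P.root i) = - P.RootForm x (P.root i) := by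
    rw [← P.rootForm_reflection_reflection_apply i x (P.root i), P.reflection_apply_self]
    simp
  rw [P.reflection_apply] at h
  simp only [map_sub, map_smul, LinearMap.sub_apply, LinearMap.smul_apply, smul_eq_mul] at h
  rw [corootVec, form_eq, map_smul, ← form_eq, smul_eq_mul, div_mul_eq_mul_div, div_eq_iff h0]
  unfold form
  linear_combination (2 / (longSq P : ℂ)) * h

end InvariantForm

/-! ### Weyl group invariance of pasted fields -/

section Invariance

open Finset Filter Topology

variable {ι V V' : Type*} [Fintype ι] [DecidableEq ι] [AddCommGroup V] [Module ℂ V]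
  [AddCommGroup V'] [Module ℂ V'] {P : RootPairing ι ℂ V V'} [P.IsRootSystem] [P.IsCrystallographic]
  {b : P.Base} {ħ β : ℂ}

-- The prefactors in `t` and `q` of the `Y_k` combine into a translation of `μ`; this is where the
-- shift in the Weyl group action comes from.
omit [P.IsRootSystem] in
lemma zeroModePart_eq_exp (μ : V) (u : YMonomial b) :
    zeroModePart ħ β μ u = Complex.exp (2 * ħ * form P (μ - weylShift b β) (wt b u)) := by
  simp only [zeroModePart, Finsupp.prod, wt, Finsupp.liftAddHom_apply, Finsupp.sum, form_eq,
    map_sum, mul_sum, Complex.exp_sum, zmultiplesHom_apply]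
  refine prod_congr rfl fun k _ => ?_
  rw [← Complex.exp_int_mul, map_zsmul, zsmul_eq_mul]
  congr 1
  simp only [weylShift, map_sub, map_smul, LinearMap.sub_apply, LinearMap.smul_apply, smul_eq_mul]
  ring

/-- A field that is pasted together from strings in direction `j` is invariant under the simple
reflection `s_j`, after passing to weights. -/
lemma IsPasted.sum_comp_reflection
    (hgeneric : ∀ m n : ℤ, qPar ħ ^ m * tPar ħ β ^ n = 1 → m = 0 ∧ n = 0)
    {j : b.support} {T : YField b} (hT : IsPasted ħ β j T) (Φ : V → ℂ) :
    T.sum (fun u c => c * Φ (wt b u)) = T.sum fun u c => c * Φ (P.reflection j (wt b u)) := by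
  obtain ⟨N, m, u, p, x, κ, hu, hx, -, hlim⟩ := hT
  set Q := qPar ħ ^ rNum P j
  set t := tPar ħ β
  have hQ : Q ≠ 0 := pow_ne_zero _ (Complex.exp_ne_zero _)
  have ht : t ≠ 0 := Complex.exp_ne_zero _
  -- `(Q t⁻¹)^n` has `t`-exponent `-n`, so genericity excludes the value `1` for `n ≠ 0`.
  have hpow (n : ℕ) (hn : n ≠ 0) : (Q * t⁻¹) ^ n ≠ 1 := by
    intro h
    have := (hgeneric ((rNum P j * n : ℕ) : ℤ) (-(n : ℤ)) (by
      rw [zpow_natCast, zpow_neg, zpow_natCast, pow_mul, ← inv_pow, ← mul_pow, h])).2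
    lia
  -- All monomials involved lie in one finite set independent of `n`, so the limits for the single
  -- monomials may be summed.
  let F : Finset (YMonomial b) :=
    T.support ∪ univ.biUnion fun r => univ.image fun S => stringMon j (u r) (p r) S
  have hF (r : Fin N) (S : Finset (Fin (m r))) : stringMon j (u r) (p r) S ∈ F :=
    mem_union_right _ (mem_biUnion.2 ⟨r, mem_univ _, mem_image_of_mem _ (mem_univ _)⟩)
  have key (Ψ : V → ℂ) : Tendsto (fun n => ∑ r, κ r n *
      ∑ S, Ψ (wt b (stringMon j (u r) (p r) S)) * stringCoeff Q t (x r n) S) atTop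
      (𝓝 (T.sum fun u c => c * Ψ (wt b u))) := by
    have hsum : (T.sum fun u c => c * Ψ (wt b u)) = ∑ v ∈ F, T v * Ψ (wt b v) :=
      Finsupp.sum_of_support_subset _ subset_union_left _ fun _ _ => zero_mul _
    rw [hsum]
    refine (tendsto_finsetSum F fun v _ => (hlim v).mul_const (Ψ (wt b v))).congr fun n => ?_
    simp only [sum_mul]
    rw [sum_comm]
    refine sum_congr rfl fun r _ => ?_
    rw [← sum_fiberwise_of_maps_to (fun S _ => hF r S), mul_sum]
    refine sum_congr rfl fun v _ => ?_
    rw [mul_assoc, sum_mul]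
    congr 1
    refine sum_congr rfl fun S hS => ?_
    rw [(mem_filter.1 hS).2, mul_comm]
  refine tendsto_nhds_unique (key Φ) ((key fun v => Φ (P.reflection j v)).congr fun n => ?_)
  refine sum_congr rfl fun r _ => ?_
  congr 1
  simp only [reflection_wt_stringMon (hu r)]
  simp only [wt_stringMon]
  -- Before the limit the two sequences agree string by string, as the weight of a term depends on
  -- `S` only through its size.
  exact (sum_stringCoeff_reverse hQ ht (hpow 2 two_ne_zero) (hpow 4 four_ne_zero) (hx r n)
    fun k => Φ (wt b (u r) + (m r : ℂ) • fundWeight b j - (k : ℂ) • P.root j)).symm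

variable [P.IsReduced]

omit [Fintype ι] [DecidableEq ι] [P.IsRootSystem] in
/-- The Weyl group is generated by the simple reflections. -/
lemma weylGroup_le_of_simple [Finite ι] (b : P.Base) (G : Subgroup P.Aut)
    (h : ∀ j ∈ b.support, RootPairing.Equiv.reflection P j ∈ G) : P.weylGroup ≤ G := by
  rw [RootPairing.weylGroup, Subgroup.closure_le]
  rintro _ ⟨i, rfl⟩
  have hw (w w' : P.Aut) (h : ∀ v : V, w • v = w' • v) : w = w' :=
    RootPairing.Equiv.weightHom_injective P (LinearEquiv.ext h)
  refine b.induction_reflect i (p := fun i => RootPairing.Equiv.reflection P i ∈ G) ?_ h ?_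
  · intro i hi
    convert hi using 1
    refine hw _ _ fun v => ?_
    simp only [RootPairing.Equiv.reflection_smul, RootPairing.reflection_reflectionPerm]
    simp
  · intro i j hi hj
    have : RootPairing.Equiv.reflection P (P.reflectionPerm j i) =
        RootPairing.Equiv.reflection P j * RootPairing.Equiv.reflection P i *
          RootPairing.Equiv.reflection P j := by
      refine hw _ _ fun v => ?_
      simp only [mul_smul, RootPairing.Equiv.reflection_smul, RootPairing.reflection_reflectionPerm]
      rfl
    rw [this]
    exact G.mul_mem (G.mul_mem (h j hj) hi) (h j hj)

lemma sum_comp_weylGroup_smul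
    (hgeneric : ∀ m n : ℤ, qPar ħ ^ m * tPar ħ β ^ n = 1 → m = 0 ∧ n = 0)
    {T : YField b} (hT : ∀ j, IsPasted ħ β j T) (w : P.weylGroup) (Φ : V → ℂ) :
    T.sum (fun u c => c * Φ (wt b u)) = T.sum fun u c => c * Φ (w • wt b u) := by
  -- Requiring invariance for all `Φ` at once is what makes this set closed under products and
  -- inverses.
  let G : Subgroup P.Aut :=
    { carrier := {g | ∀ Φ : V → ℂ,
        T.sum (fun u c => c * Φ (wt b u)) = T.sum fun u c => c * Φ (g • wt b u)}
      one_mem' := fun Φ => by simp only [one_smul]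
      mul_mem' := fun {g g'} hg hg' Φ => by
        simp only [mul_smul]
        rw [hg Φ, hg' fun v => Φ (g • v)]
      inv_mem' := fun {g} hg Φ => by
        rw [hg fun v => Φ (g⁻¹ • v)]
        simp only [inv_smul_smul] }
  exact weylGroup_le_of_simple b G (fun j hj Φ => (hT ⟨j, hj⟩).sum_comp_reflection hgeneric Φ) w.2 Φ

end Invariance

/-! ### Invariants of a lattice group algebra and separation of orbits -/

section InvariantTheory

open AddMonoidAlgebra Finset

variable {Λ G I : Type*} [AddCommGroup Λ] [Group G] [DistribMulAction G Λ]

/-- The action of a group element on the group algebra of a lattice. -/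
def latticeAct (g : G) : AddMonoidAlgebra ℂ Λ →ₐ[ℂ] AddMonoidAlgebra ℂ Λ :=
  mapDomainAlgHom ℂ ℂ (DistribSMul.toAddMonoidHom Λ g)

lemma latticeAct_single (g : G) (v : Λ) (c : ℂ) :
    latticeAct g (single v c) = single (g • v) c := by
  simp [latticeAct]

lemma coeff_smul_of_invariant {f : AddMonoidAlgebra ℂ Λ} (hf : ∀ g : G, latticeAct g f = f) (g : G)
    (v : Λ) : f.coeff (g • v) = f.coeff v := by
  conv_lhs => rw [← hf g]
  exact Finsupp.mapDomain_apply (MulAction.injective g) _ _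

/-- Elements of the group algebra all of whose weights have height less than `n`. -/
def lowerThan (ht : Λ →+ ℤ) (n : ℤ) : Submodule ℂ (AddMonoidAlgebra ℂ Λ) where
  carrier := {f | ∀ v, n ≤ ht v → f.coeff v = 0}
  add_mem' := fun hf hg v hv => by simp [hf v hv, hg v hv]
  zero_mem' := fun v _ => by simp
  smul_mem' := fun c f hf v hv => by simp [hf v hv]

variable {ht : Λ →+ ℤ}

lemma lowerThan_mono {m n : ℤ} (h : m ≤ n) : lowerThan ht m ≤ lowerThan ht n :=
  fun _ hf v hv => hf v (h.trans hv)

lemma single_mem_lowerThan {v : Λ} {c : ℂ} {n : ℤ} (h : ht v < n) :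
    single v c ∈ lowerThan ht n := by
  intro w hw
  have : v ≠ w := by rintro rfl; lia
  simp [this]

lemma mul_mem_lowerThan {f g : AddMonoidAlgebra ℂ Λ} {m n : ℤ} (hf : f ∈ lowerThan ht m)
    (hg : g ∈ lowerThan ht n) : f * g ∈ lowerThan ht (m + n - 1) := by
  classical
  intro v hv
  by_contra h
  obtain ⟨a, ha, c, hc, rfl⟩ := Finset.mem_add.1
    (support_coeff_mul_subset f g (Finsupp.mem_support_iff.2 h))
  have h1 : ht a < m := by
    by_contra h'
    exact Finsupp.mem_support_iff.1 ha (hf a (not_lt.1 h'))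
  have h2 : ht c < n := by
    by_contra h'
    exact Finsupp.mem_support_iff.1 hc (hg c (not_lt.1 h'))
  rw [map_add] at hv
  lia

/-- `f` is `e^v` plus terms of smaller height. -/
def IsMonicAt (ht : Λ →+ ℤ) (v : Λ) (f : AddMonoidAlgebra ℂ Λ) : Prop :=
  f - single v 1 ∈ lowerThan ht (ht v)

lemma IsMonicAt.mem_lowerThan {v : Λ} {f : AddMonoidAlgebra ℂ Λ} (h : IsMonicAt ht v f) :
    f ∈ lowerThan ht (ht v + 1) := by
  rw [← sub_add_cancel f (single v 1)]
  exact add_mem (lowerThan_mono (by lia) h) (single_mem_lowerThan (by lia))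

lemma isMonicAt_one : IsMonicAt ht 0 1 := by
  rw [IsMonicAt, one_def, sub_self]
  exact zero_mem _

lemma IsMonicAt.mul {v w : Λ} {f g : AddMonoidAlgebra ℂ Λ} (hf : IsMonicAt ht v f)
    (hg : IsMonicAt ht w g) : IsMonicAt ht (v + w) (f * g) := by
  have h : f * g - single (v + w) 1 = (f - single v 1) * g + single v 1 * (g - single w 1) := by
    have : (single (v + w) 1 : AddMonoidAlgebra ℂ Λ) = single v 1 * single w 1 := by
      rw [single_mul_single, one_mul]
    rw [this]
    ring
  rw [IsMonicAt, h, map_add]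
  have h1 := mul_mem_lowerThan hf hg.mem_lowerThan
  have h2 := mul_mem_lowerThan (single_mem_lowerThan (c := 1) (lt_add_one (ht v))) hg
  exact add_mem (lowerThan_mono (by lia) h1) (lowerThan_mono (by lia) h2)

lemma IsMonicAt.pow {v : Λ} {f : AddMonoidAlgebra ℂ Λ} (hf : IsMonicAt ht v f) (n : ℕ) :
    IsMonicAt ht (n • v) (f ^ n) := by
  induction n with
  | zero => simpa using isMonicAt_one
  | succ n ih => rw [pow_succ, succ_nsmul]; exact ih.mul hf

lemma isMonicAt_prod {v : I → Λ} {f : I → AddMonoidAlgebra ℂ Λ} (hf : ∀ i, IsMonicAt ht (v i) (f i))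
    (s : Finset I) : IsMonicAt ht (∑ i ∈ s, v i) (∏ i ∈ s, f i) := by
  classical
  induction s using Finset.induction_on with
  | empty => simpa using isMonicAt_one
  | insert a s ha ih => rw [sum_insert ha, prod_insert ha]; exact (hf a).mul ih

/-- Invariants of a lattice under a group are generated by invariants `χ_i` with leading terms
`e^{ω_i}`, if every weight is a non-negative combination of the `ω_i` or can be raised by the
group. Stated for the values of two characters of the group algebra. -/
theorem eval_eq_of_forall_fundamental [Fintype I] {ω : I → Λ} {χ : I → AddMonoidAlgebra ℂ Λ}
    (hinv : ∀ i, ∀ g : G, latticeAct g (χ i) = χ i) (hmonic : ∀ i, IsMonicAt ht (ω i) (χ i))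
    (hω : ∀ i, 0 ≤ ht (ω i))
    (hdom : ∀ v : Λ, (∃ g : G, ht v < ht (g • v)) ∨ ∃ n : I → ℕ, v = ∑ i, n i • ω i)
    {e e' : AddMonoidAlgebra ℂ Λ →ₐ[ℂ] ℂ} (h : ∀ i, e (χ i) = e' (χ i))
    {f : AddMonoidAlgebra ℂ Λ} (hf : ∀ g : G, latticeAct g f = f) : e f = e' f := by
  classical
  suffices key : ∀ (n : ℕ) (f : AddMonoidAlgebra ℂ Λ), (∀ g : G, latticeAct g f = f) →
      f ∈ lowerThan ht n → e f = e' f by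
    refine key ((f.coeff.support.sup fun v => (ht v).toNat) + 1) f hf fun v hv => ?_
    by_contra hne
    have := Finset.le_sup (f := fun v => (ht v).toNat) (Finsupp.mem_support_iff.2 hne)
    push_cast at hv
    lia
  intro n
  induction n with
  | zero =>
    intro f hf hlow
    suffices f = 0 by rw [this, map_zero, map_zero]
    by_contra hne
    have hs : f.coeff.support.Nonempty := by
      rw [Finsupp.support_nonempty_iff]
      exact fun h0 => hne (AddMonoidAlgebra.ext h0)
    -- A support weight of maximal height cannot be raised, so it is a non-negative combination of
    -- the `ω_i`; but all heights in the support are negative.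
    obtain ⟨v, hv, hmax⟩ := exists_max_image _ ht hs
    have hv0 : ht v < 0 := by
      by_contra h'
      exact Finsupp.mem_support_iff.1 hv (hlow v (by simpa using h'))
    rcases hdom v with ⟨g, hg⟩ | ⟨k, hk⟩
    · refine (hmax (g • v) ?_).not_gt hg
      rw [Finsupp.mem_support_iff, coeff_smul_of_invariant hf]
      exact Finsupp.mem_support_iff.1 hv
    · rw [hk, map_sum] at hv0
      refine hv0.not_ge (sum_nonneg fun i _ => ?_)
      rw [map_nsmul]
      exact nsmul_nonneg (hω i) _
  | succ n ih =>
    intro f hf hlow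
    set top := f.coeff.support.filter fun v => ht v = n with htop
    -- By invariance, raising a top weight would produce a support weight above height `n`; hence
    -- top weights are dominant.
    have hex : ∀ v, ∃ k : I → ℕ, v ∈ top → v = ∑ i, k i • ω i := by
      intro v
      by_cases hv : v ∈ top
      · rw [htop, mem_filter] at hv
        rcases hdom v with ⟨g, hg⟩ | ⟨k, hk⟩
        · exfalso
          have h0 := hlow (g • v) (by push_cast; lia)
          rw [coeff_smul_of_invariant hf] at h0
          exact Finsupp.mem_support_iff.1 hv.1 h0
        · exact ⟨k, fun _ => hk⟩
      · exact ⟨0, fun h => absurd h hv⟩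
    choose k hk using hex
    let M : Λ → AddMonoidAlgebra ℂ Λ := fun v => ∏ i, χ i ^ k v i
    have hM : ∀ v ∈ top, IsMonicAt ht v (M v) := by
      intro v hv
      have := isMonicAt_prod (fun i => (hmonic i).pow (k v i)) univ
      rwa [← hk v hv] at this
    have hMinv : ∀ v, ∀ g : G, latticeAct g (M v) = M v := by
      intro v g
      simp only [M, map_prod, map_pow, hinv]
    have hMe : ∀ v, e (M v) = e' (M v) := by
      intro v
      simp only [M, map_prod, map_pow, h]
    -- Subtracting the matching products of the `χ_i` removes the whole layer of height `n` and
    -- stays among the invariants.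
    have hsub := ih (f - ∑ v ∈ top, f.coeff v • M v) (fun g => by
      simp only [map_sub, map_sum, map_smul, hf, hMinv]) ?_
    · simp only [map_sub, map_sum, map_smul, hMe] at hsub
      exact sub_left_injective hsub
    · have hsplit : f - ∑ v ∈ top, f.coeff v • M v =
          (f - ∑ v ∈ top, f.coeff v • single v 1) - ∑ v ∈ top, f.coeff v • (M v - single v 1) := by
        simp only [smul_sub, sum_sub_distrib]
        abel
      rw [hsplit]
      refine sub_mem ?_ (sum_mem fun v hv => Submodule.smul_mem _ _ ?_)
      · intro v hv
        have hc : (∑ w ∈ top, f.coeff w • (single w 1 : AddMonoidAlgebra ℂ Λ)).coeff v =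
            if v ∈ top then f.coeff v else 0 := by
          simp [AddMonoidAlgebra.coeff_sum, Finsupp.finsetSum_apply, Finsupp.single_apply]
        rw [coeff_sub, Finsupp.sub_apply, hc]
        split_ifs with hmem
        · exact sub_self _
        · rw [sub_zero]
          by_contra hne
          rcases hv.eq_or_lt with heq | hlt
          · exact hmem (mem_filter.2 ⟨Finsupp.mem_support_iff.2 hne, heq.symm⟩)
          · exact hne (hlow v (by push_cast; lia))
      · have := hM v hv
        rwa [IsMonicAt, (mem_filter.1 hv).2] at this

/-- The translate of a character of the lattice by a group element. -/
def characterSMul (φ : Multiplicative Λ →* ℂ) (g : G) : Multiplicative Λ →* ℂ :=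
  φ.comp (AddMonoidHom.toMultiplicative (DistribSMul.toAddMonoidHom Λ g))

/-- Characters of a lattice that agree on all invariants of a finite group are conjugate. -/
theorem exists_characterSMul_eq [Finite G] {φ φ' : Multiplicative Λ →* ℂ}
    (h : ∀ f : AddMonoidAlgebra ℂ Λ, (∀ g : G, latticeAct g f = f) →
      lift ℂ ℂ Λ φ f = lift ℂ ℂ Λ φ' f) :
    ∃ g : G, characterSMul φ g = φ' := by
  classical
  have := Fintype.ofFinite G
  by_contra! hne
  -- The hypothesis is applied to the orbit sum of `e^v`.
  have hsum (v : Λ) : ∑ g : G, φ (.ofAdd (g • v)) = ∑ g : G, φ' (.ofAdd (g • v)) := by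
    have := h (∑ g : G, single (g • v) 1) fun g => by
      simp only [map_sum, latticeAct_single, ← mul_smul]
      exact Fintype.sum_equiv (Equiv.mulLeft g) _ _ fun _ => rfl
    simpa using this
  let c : (Multiplicative Λ →* ℂ) →₀ ℂ :=
    ∑ g : G, (Finsupp.single (characterSMul φ g) 1 - Finsupp.single (characterSMul φ' g) 1)
  have hc : c = 0 := by
    refine (linearIndependent_iff.1 (linearIndependent_monoidHom (Multiplicative Λ) ℂ)) c ?_
    funext v
    simp only [c, map_sum, map_sub, Finsupp.linearCombination_single, one_smul, Finset.sum_apply,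
      Pi.sub_apply, sum_sub_distrib, Pi.zero_apply]
    exact sub_eq_zero.2 (hsum v.toAdd)
  -- If no translate of `φ` equals `φ'`, the coefficient of `φ'` is minus the order of its
  -- stabilizer, which contains `1`: a contradiction.
  have hval := DFunLike.congr_fun hc φ'
  simp only [c, Finsupp.finsetSum_apply, Finsupp.sub_apply, Finsupp.single_apply, hne, if_false,
    zero_sub, sum_neg_distrib, Finsupp.zero_apply, neg_eq_zero, sum_boole, Nat.cast_eq_zero,
    card_eq_zero, filter_eq_empty_iff] at hval
  exact hval (mem_univ (1 : G)) (MonoidHom.ext fun v => by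
    simp [characterSMul])

end InvariantTheory

/-! ### The weight lattice, characters of fields, and conjugacy -/

section WeightLattice

variable {ι V V' : Type*} [Fintype ι] [DecidableEq ι] [AddCommGroup V] [Module ℂ V]
  [AddCommGroup V'] [Module ℂ V'] {P : RootPairing ι ℂ V V'} [P.IsRootSystem]

/-- The lattice of integral weights. -/
def weightLattice (b : P.Base) : Submodule ℤ V := Submodule.span ℤ (Set.range (fundBasis b))

lemma mem_weightLattice_iff {b : P.Base} {v : V} :
    v ∈ weightLattice b ↔ ∀ i : b.support, ∃ n : ℤ, (n : ℂ) = P.coroot' i v := by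
  rw [weightLattice, (fundBasis b).mem_span_iff_repr_mem ℤ]
  simp only [fundBasis_repr]
  rfl

/-- The `i`-th Dynkin label of an integral weight. -/
def dynkinLabel (b : P.Base) (i : b.support) : weightLattice b →+ ℤ :=
  ((Finsupp.lapply i).comp ((fundBasis b).restrictScalars ℤ).repr.toLinearMap).toAddMonoidHom

lemma cast_dynkinLabel {b : P.Base} (i : b.support) (v : weightLattice b) :
    (dynkinLabel b i v : ℂ) = P.coroot' i (v : V) := by
  rw [← fundBasis_repr]
  exact (fundBasis b).restrictScalars_repr_apply ℤ v i

/-- The height function with weights `c`. -/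
def latticeHeight (b : P.Base) (c : b.support → ℕ) : weightLattice b →+ ℤ :=
  ∑ i, c i • dynkinLabel b i

lemma cast_latticeHeight {b : P.Base} (c : b.support → ℕ) (v : weightLattice b) :
    (latticeHeight b c v : ℂ) = (∑ i : b.support, (c i : ℂ) • P.coroot' i) (v : V) := by
  simp [latticeHeight, AddMonoidHom.finsetSum_apply, cast_dynkinLabel]

variable [P.IsCrystallographic]

lemma fundWeight_mem (b : P.Base) (i : b.support) : fundWeight b i ∈ weightLattice b := by
  rw [fundWeight_eq]
  exact Submodule.subset_span ⟨i, rfl⟩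

lemma wt_mem (b : P.Base) (u : YMonomial b) : wt b u ∈ weightLattice b := by
  simp only [wt, Finsupp.liftAddHom_apply, Finsupp.sum, zmultiplesHom_apply]
  exact sum_mem fun k _ => Submodule.smul_mem _ _ (fundWeight_mem b k.1)

omit [Fintype ι] [DecidableEq ι] [P.IsRootSystem] in
lemma sum_coroot'_root {b : P.Base} (c : b.support → ℕ) (j : ι) :
    (∑ i : b.support, (c i : ℂ) • P.coroot' i) (P.root j) =
      ((∑ i : b.support, (c i : ℤ) * P.pairingIn ℤ j i : ℤ) : ℂ) := by
  simp [LinearMap.sum_apply, ← P.algebraMap_pairingIn ℤ]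

variable [P.IsReduced]

lemma weylGroup_smul_mem {b : P.Base} (w : P.weylGroup) {v : V} (hv : v ∈ weightLattice b) :
    w • v ∈ weightLattice b := by
  have hrefl : ∀ j : b.support, ∀ v ∈ weightLattice b, P.reflection j v ∈ weightLattice b := by
    intro j v hv
    rw [mem_weightLattice_iff] at hv ⊢
    intro i
    obtain ⟨n, hn⟩ := hv i
    obtain ⟨k, hk⟩ := hv j
    refine ⟨n - k * P.pairingIn ℤ j i, ?_⟩
    rw [P.reflection_apply, map_sub, map_smul, P.root_coroot'_eq_pairing, ← hn, ← hk,
      ← P.algebraMap_pairingIn ℤ]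
    simp
  let G : Subgroup P.Aut :=
    { carrier := {g | ∀ v : V, g • v ∈ weightLattice b ↔ v ∈ weightLattice b}
      one_mem' := fun _ => by simp only [one_smul]
      mul_mem' := fun {g g'} hg hg' v => by
        rw [mul_smul]
        exact (hg _).trans (hg' v)
      inv_mem' := fun {g} hg v => by
        rw [← hg, smul_inv_smul] }
  refine (weylGroup_le_of_simple b G (fun j hj v => ⟨fun h => ?_, hrefl ⟨j, hj⟩ v⟩) w.2 v).2 hv
  simpa using hrefl ⟨j, hj⟩ _ h

instance weightLatticeAction (b : P.Base) : DistribMulAction P.weylGroup (weightLattice b) where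
  smul w v := ⟨w • (v : V), weylGroup_smul_mem w v.2⟩
  one_smul _ := Subtype.ext (one_smul _ _)
  mul_smul w w' v := Subtype.ext (mul_smul w w' (v : V))
  smul_zero w := Subtype.ext (smul_zero w)
  smul_add w v v' := Subtype.ext (smul_add w (v : V) v')

lemma coe_weylGroup_smul {b : P.Base} (w : P.weylGroup) (v : weightLattice b) :
    ((w • v : weightLattice b) : V) = w • (v : V) := rfl

/-- The character of a field: the sum of the weights of its monomials, with coefficients. -/
def fieldChar {b : P.Base} (T : YField b) : AddMonoidAlgebra ℂ (weightLattice b) :=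
  T.sum fun u c => AddMonoidAlgebra.single ⟨wt b u, wt_mem b u⟩ c

variable {b : P.Base} {ħ β : ℂ}

lemma latticeAct_fieldChar
    (hgeneric : ∀ m n : ℤ, qPar ħ ^ m * tPar ħ β ^ n = 1 → m = 0 ∧ n = 0)
    {T : YField b} (hT : ∀ j, IsPasted ħ β j T) (w : P.weylGroup) :
    latticeAct w (fieldChar T) = fieldChar T := by
  classical
  ext v
  -- Testing against the indicator function of `v` extracts the coefficient at `v`.
  have h := sum_comp_weylGroup_smul hgeneric hT w fun x => if x = v then 1 else 0
  simp only [fieldChar, Finsupp.sum, map_sum, latticeAct_single, AddMonoidAlgebra.coeff_sum,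
    Finsupp.finsetSum_apply, AddMonoidAlgebra.coeff_single, Finsupp.single_apply, Subtype.ext_iff,
    coe_weylGroup_smul]
  simp only [Finsupp.sum, mul_ite, mul_one, mul_zero] at h
  exact h.symm

-- Every monomial other than `Y_i` contains at least one `A_j⁻¹`, and each of these lowers the
-- height by a positive amount.
omit [P.IsReduced] in
lemma isMonicAt_fieldChar {c : b.support → ℕ}
    (hc : ∀ j : b.support, 0 < ∑ i, (c i : ℤ) * P.pairingIn ℤ j i) {i : b.support} {T : YField b}
    (hT : IsGenerator ħ β i T) :
    IsMonicAt (latticeHeight b c) ⟨fundWeight b i, fundWeight_mem b i⟩ (fieldChar T) := by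
  classical
  have hy : yMon i 0 0 ∈ T.support := by
    rw [Finsupp.mem_support_iff, hT.leading]
    exact one_ne_zero
  have hwt : (⟨wt b (yMon i 0 0), wt_mem b _⟩ : weightLattice b) =
      ⟨fundWeight b i, fundWeight_mem b i⟩ := Subtype.ext (wt_yMon b i 0 0)
  rw [IsMonicAt, fieldChar, Finsupp.sum, ← Finset.add_sum_erase _ _ hy, hT.leading, hwt,
    add_sub_cancel_left]
  refine sum_mem fun u hu => single_mem_lowerThan ?_
  obtain ⟨hne, hu⟩ := Finset.mem_erase.1 hu
  obtain ⟨L, rfl⟩ := hT.lower u hu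
  have hL : L ≠ [] := by
    rintro rfl
    simp at hne
  have hcast : latticeHeight b c ⟨wt b (yMon i 0 0 - (L.map fun k => aMon k.1 k.2.1 k.2.2).sum),
      wt_mem b _⟩ = latticeHeight b c ⟨fundWeight b i, fundWeight_mem b i⟩ -
        (L.map fun k => ∑ i : b.support, (c i : ℤ) * P.pairingIn ℤ k.1 i).sum := by
    apply Int.cast_injective (α := ℂ)
    rw [Int.cast_sub, cast_latticeHeight, cast_latticeHeight]
    simp only
    rw [map_sub, wt_yMon, map_sub, map_list_sum, map_list_sum, Int.cast_list_sum,
      List.map_map, List.map_map, List.map_map]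
    congr 3
    funext k
    simp only [Function.comp_apply, wt_aMon, sum_coroot'_root]
  rw [hcast]
  have hpos : 0 < (L.map fun k => ∑ i : b.support, (c i : ℤ) * P.pairingIn ℤ k.1 i).sum := by
    refine List.sum_pos _ (fun x hx => ?_) (by simpa using hL)
    obtain ⟨k, -, rfl⟩ := List.mem_map.1 hx
    exact hc k.1
  lia

/-- If the `j`-th Dynkin label is negative, `s_j` adds a positive multiple of `α_j`; otherwise the
labels themselves are the coefficients. -/
lemma exists_height_lt_or_eq_sum {c : b.support → ℕ}
    (hc : ∀ j : b.support, 0 < ∑ i, (c i : ℤ) * P.pairingIn ℤ j i) (v : weightLattice b) :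
    (∃ w : P.weylGroup, latticeHeight b c v < latticeHeight b c (w • v)) ∨
      ∃ n : b.support → ℕ, v = ∑ i, n i •
        (⟨fundWeight b i, fundWeight_mem b i⟩ : weightLattice b) := by
  by_cases hneg : ∃ j, dynkinLabel b j v < 0
  · obtain ⟨j, hj⟩ := hneg
    refine Or.inl ⟨RootPairing.weylGroup.ofIdx P j, ?_⟩
    have hcast : latticeHeight b c (RootPairing.weylGroup.ofIdx P (j : ι) • v) =
        latticeHeight b c v - dynkinLabel b j v * ∑ i, (c i : ℤ) * P.pairingIn ℤ j i := by
      apply Int.cast_injective (α := ℂ)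
      rw [Int.cast_sub, Int.cast_mul, cast_latticeHeight, cast_latticeHeight, cast_dynkinLabel,
        ← sum_coroot'_root, coe_weylGroup_smul, RootPairing.weylGroup.ofIdx_smul,
        RootPairing.Equiv.reflection_smul, P.reflection_apply, map_sub, map_smul, smul_eq_mul]
    rw [hcast]
    nlinarith [hc j]
  · push Not at hneg
    refine Or.inr ⟨fun i => (dynkinLabel b i v).toNat, Subtype.ext ?_⟩
    rw [← sum_coroot'_smul_fundWeight b v]
    simp only [AddSubmonoidClass.coe_finsetSum]
    refine Finset.sum_congr rfl fun i _ => ?_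
    have hi : (((dynkinLabel b i v).toNat : ℤ) : ℂ) = dynkinLabel b i v := by
      rw [Int.toNat_of_nonneg (hneg i)]
    rw [Int.cast_natCast] at hi
    rw [← cast_dynkinLabel, ← hi, Nat.cast_smul_eq_nsmul]
    rfl

/-- The character `v ↦ q^{2 (μ - r^∨ ρ + β ρ^∨, v)}` of the weight lattice. -/
def weightCharacter (b : P.Base) (ħ β : ℂ) (μ : V) : Multiplicative (weightLattice b) →* ℂ where
  toFun v := Complex.exp (2 * ħ * form P (μ - weylShift b β) (v.toAdd : V))
  map_one' := by simp [form]
  map_mul' v w := by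
    rw [← Complex.exp_add, toAdd_mul, Submodule.coe_add, form_eq, map_add, mul_add]
    rfl

omit [P.IsReduced] in
lemma lift_weightCharacter_fieldChar (μ : V) (T : YField b) :
    AddMonoidAlgebra.lift ℂ ℂ _ (weightCharacter b ħ β μ) (fieldChar T) =
      highestWeight ħ β T μ := by
  rw [highestWeight_eq_sum, fieldChar, Finsupp.sum, map_sum]
  refine Finset.sum_congr rfl fun u _ => ?_
  rw [AddMonoidAlgebra.lift_single, smul_eq_mul]
  simp only [zeroModePart_eq_exp]
  rfl

lemma highestWeight_eq_of_exp_eq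
    (hgeneric : ∀ m n : ℤ, qPar ħ ^ m * tPar ħ β ^ n = 1 → m = 0 ∧ n = 0)
    {T : YField b} (hT : ∀ j, IsPasted ħ β j T) {μ μ' : V} (w : P.weylGroup)
    (h : ∀ v ∈ weightLattice b, Complex.exp (2 * ħ * form P (μ' - weylShift b β) v) =
      Complex.exp (2 * ħ * form P (w • (μ - weylShift b β)) v)) :
    highestWeight ħ β T μ = highestWeight ħ β T μ' := by
  rw [highestWeight_eq_sum, highestWeight_eq_sum]
  simp only [zeroModePart_eq_exp]
  rw [sum_comp_weylGroup_smul hgeneric hT w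
    fun v => Complex.exp (2 * ħ * form P (μ' - weylShift b β) v)]
  refine Finset.sum_congr rfl fun u _ => ?_
  simp only [h _ (weylGroup_smul_mem w (wt_mem b u)), form_weylGroup_smul]

lemma exists_exp_eq_of_highestWeight_eq
    (hgeneric : ∀ m n : ℤ, qPar ħ ^ m * tPar ħ β ^ n = 1 → m = 0 ∧ n = 0)
    {T : b.support → YField b} (hT : ∀ i, IsGenerator ħ β i (T i)) {μ μ' : V}
    (h : ∀ i, highestWeight ħ β (T i) μ = highestWeight ħ β (T i) μ') :
    ∃ w : P.weylGroup, ∀ v ∈ weightLattice b,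
      Complex.exp (2 * ħ * form P (μ' - weylShift b β) v) =
        Complex.exp (2 * ħ * form P (w • (μ - weylShift b β)) v) := by
  obtain ⟨c, hc⟩ := exists_nat_sum_pairingIn_pos' b
  have hω (i : b.support) :
      0 ≤ latticeHeight b c (⟨fundWeight b i, fundWeight_mem b i⟩ : weightLattice b) := by
    have : latticeHeight b c (⟨fundWeight b i, fundWeight_mem b i⟩ : weightLattice b) = c i := by
      apply Int.cast_injective (α := ℂ)
      rw [cast_latticeHeight]
      simp only [LinearMap.sum_apply, LinearMap.smul_apply, coroot'_fundWeight, smul_eq_mul,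
        mul_ite, mul_one, mul_zero, Finset.sum_ite_eq, Finset.mem_univ, if_true, Int.cast_natCast]
    rw [this]
    positivity
  obtain ⟨w, hw⟩ := exists_characterSMul_eq (G := P.weylGroup) (φ := weightCharacter b ħ β μ)
    (φ' := weightCharacter b ħ β μ') fun f hf =>
      eval_eq_of_forall_fundamental (fun i => latticeAct_fieldChar hgeneric (hT i).pasted)
        (fun i => isMonicAt_fieldChar hc (hT i)) hω (exists_height_lt_or_eq_sum hc)
        (fun i => by rw [lift_weightCharacter_fieldChar, lift_weightCharacter_fieldChar, h i]) hf
  -- Translating the character by `w` moves its parameter by `w⁻¹`, by invariance of the form.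
  refine ⟨w⁻¹, fun v hv => ?_⟩
  have := DFunLike.congr_fun hw (Multiplicative.ofAdd ⟨v, hv⟩)
  rw [← form_weylGroup_smul P w (w⁻¹ • _), smul_inv_smul]
  exact this.symm

end WeightLattice

/-! ### The group `P_ℚ + β P_ℚ` and the consequence of genericity -/

section Rationality

variable {ι V V' : Type*} [Fintype ι] [AddCommGroup V] [Module ℂ V]
  [AddCommGroup V'] [Module ℂ V'] {P : RootPairing ι ℂ V V'} [P.IsCrystallographic]

/-- `z ∈ ℚ + β ℚ`. -/
def ratPlane (β : ℂ) : Submodule ℚ ℂ where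
  carrier := {z | ∃ x y : ℚ, z = x + β * y}
  add_mem' := by
    rintro _ _ ⟨x, y, rfl⟩ ⟨x', y', rfl⟩
    exact ⟨x + x', y + y', by push_cast; ring⟩
  zero_mem' := ⟨0, 0, by simp⟩
  smul_mem' := by
    rintro c _ ⟨x, y, rfl⟩
    exact ⟨c * x, c * y, by rw [Rat.smul_def]; push_cast; ring⟩

lemma mul_mem_ratPlane {β z : ℂ} (c : ℚ) (hz : z ∈ ratPlane β) : (c : ℂ) * z ∈ ratPlane β := by
  rw [← Rat.smul_def]
  exact Submodule.smul_mem _ _ hz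

lemma ratCast_mem_ratPlane (β : ℂ) (x : ℚ) : (x : ℂ) ∈ ratPlane β := ⟨x, 0, by simp⟩

lemma mul_ratCast_mem_ratPlane (β : ℂ) (x : ℚ) : β * (x : ℂ) ∈ ratPlane β := ⟨0, x, by simp⟩

omit [Fintype ι] [P.IsCrystallographic] in
lemma isRationalWeight_iff {b : P.Base} {β : ℂ} {v : V} : IsRationalWeight b β v ↔
    ∃ z : b.support → ℂ, (∀ i, z i ∈ ratPlane β) ∧ v = ∑ i, z i • P.root i := by
  constructor
  · rintro ⟨x, y, rfl⟩
    exact ⟨_, fun i => ⟨x i, y i, rfl⟩, rfl⟩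
  · rintro ⟨z, hz, rfl⟩
    choose x y hxy using hz
    exact ⟨x, y, by simp only [hxy]⟩

/-- The subgroup `P_ℚ + β P_ℚ`. -/
def ratWeights (b : P.Base) (β : ℂ) : AddSubgroup V where
  carrier := {v | IsRationalWeight b β v}
  add_mem' := by
    intro v w hv hw
    obtain ⟨z, hz, rfl⟩ := isRationalWeight_iff.1 hv
    obtain ⟨z', hz', rfl⟩ := isRationalWeight_iff.1 hw
    exact isRationalWeight_iff.2 ⟨fun i => z i + z' i, fun i => add_mem (hz i) (hz' i), by
      simp only [add_smul, Finset.sum_add_distrib]⟩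
  zero_mem' := isRationalWeight_iff.2 ⟨fun _ => 0, fun _ => zero_mem _, by simp⟩
  neg_mem' := by
    intro v hv
    obtain ⟨z, hz, rfl⟩ := isRationalWeight_iff.1 hv
    exact isRationalWeight_iff.2 ⟨fun i => -z i, fun i => neg_mem (hz i), by simp⟩

omit [Fintype ι] [P.IsCrystallographic] in
lemma smul_root_mem_ratWeights (b : P.Base) {β z : ℂ} (hz : z ∈ ratPlane β) (k : ι) :
    z • P.root k ∈ ratWeights b β := by
  obtain ⟨f, -, -, hf⟩ := b.exists_root_eq_sum_int k
  refine isRationalWeight_iff.2 ⟨fun i => z * ((f i : ℚ) : ℂ), fun i => ?_, ?_⟩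
  · simp only [mul_comm z]
    exact mul_mem_ratPlane _ hz
  · rw [hf, Finset.smul_sum, ← Finset.sum_coe_sort]
    refine Finset.sum_congr rfl fun i _ => ?_
    rw [← Int.cast_smul_eq_zsmul ℂ, smul_smul]
    norm_cast

omit [Fintype ι] [P.IsCrystallographic] in
lemma weylGroup_smul_mem_ratWeights {b : P.Base} {β : ℂ} (w : P.weylGroup) {v : V}
    (hv : v ∈ ratWeights b β) : w • v ∈ ratWeights b β := by
  obtain ⟨z, hz, rfl⟩ := isRationalWeight_iff.1 hv
  rw [Finset.smul_sum]
  refine sum_mem fun i _ => ?_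
  have : w • (z i • P.root i) = z i • w • P.root i := smul_comm (w : P.Aut) (z i) (P.root i)
  rw [this, P.weylGroup_apply_root]
  exact smul_root_mem_ratWeights b (hz i) _

variable (P) in
/-- Half the squared length of a root, a rational number. -/
def halfSq (i : ι) : ℚ := rootSq P i / longSq P

lemma form_root_root_eq (i : ι) : form P (P.root i) (P.root i) = 2 * (halfSq P i : ℂ) := by
  rw [form_root_root, halfSq]
  push_cast
  ring

lemma halfSq_ne_zero (i : ι) : halfSq P i ≠ 0 :=
  div_ne_zero (Nat.cast_ne_zero.2 (rootSq_pos P i).ne') (Nat.cast_ne_zero.2 (longSq_pos P i).ne')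

lemma corootVec_eq (i : ι) : corootVec P i = (((halfSq P i)⁻¹ : ℚ) : ℂ) • P.root i := by
  rw [corootVec, form_root_root_eq, Rat.cast_inv, div_mul_cancel_left₀ two_ne_zero]

/-- Coroots are rational multiples of roots, so `ρ^∨` as well as `ρ` lies in the rational span. -/
lemma weylShift_mem_ratWeights (b : P.Base) (β : ℂ) : weylShift b β ∈ ratWeights b β := by
  rw [weylShift, rho, rhoCheck]
  simp only [Finset.smul_sum, corootVec_eq, smul_smul]
  refine sub_mem (sum_mem fun k _ => smul_root_mem_ratWeights b ?_ k)
    (sum_mem fun k _ => smul_root_mem_ratWeights b ?_ k)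
  · simpa using ratCast_mem_ratPlane β (dualTier P * (1 / 2))
  · simpa using mul_ratCast_mem_ratPlane β ((1 / 2) * (halfSq P k)⁻¹)

lemma shiftedAction_mem_ratWeights {b : P.Base} {β : ℂ} (w : P.weylGroup) {μ : V}
    (hμ : μ ∈ ratWeights b β) : shiftedAction b β w μ ∈ ratWeights b β :=
  add_mem (weylGroup_smul_mem_ratWeights w (sub_mem hμ (weylShift_mem_ratWeights b β)))
    (weylShift_mem_ratWeights b β)

lemma ne_zero_of_generic {ħ β : ℂ}
    (hgeneric : ∀ m n : ℤ, qPar ħ ^ m * tPar ħ β ^ n = 1 → m = 0 ∧ n = 0) : ħ ≠ 0 := by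
  rintro rfl
  have := (hgeneric 1 0 (by simp [qPar])).1
  lia

lemma eq_zero_of_int_mul_pi_mem {ħ β : ℂ}
    (hgeneric : ∀ m n : ℤ, qPar ħ ^ m * tPar ħ β ^ n = 1 → m = 0 ∧ n = 0) {n : ℤ}
    (h : Real.pi * Complex.I / ħ * n ∈ ratPlane β) : n = 0 := by
  have hħ := ne_zero_of_generic hgeneric
  obtain ⟨x, y, hxy⟩ := h
  have hx : (x : ℂ) * x.den = x.num := by exact_mod_cast Rat.mul_den_eq_num x
  have hy : (y : ℂ) * y.den = y.num := by exact_mod_cast Rat.mul_den_eq_num y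
  -- From `πi n = ħ (x + β y)`, multiplied by `2` and both denominators: the right side is in `2πi
  -- ℤ`, so exponentiating gives a relation between `q` and `t`. Its exponents vanish, and then so
  -- does `n`.
  have e : ((2 * x.num * y.den : ℤ) : ℂ) * ħ + ((2 * y.num * x.den : ℤ) : ℂ) * (β * ħ) =
      ((n * x.den * y.den : ℤ) : ℂ) * (2 * Real.pi * Complex.I) := by
    push_cast
    rw [div_mul_eq_mul_div, div_eq_iff hħ] at hxy
    rw [← hx, ← hy]
    linear_combination (-2 * (x.den : ℂ) * y.den) * hxy
  have h1 := hgeneric (2 * x.num * y.den) (2 * y.num * x.den) (by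
    rw [qPar, tPar, ← Complex.exp_int_mul, ← Complex.exp_int_mul, ← Complex.exp_add, e]
    exact Complex.exp_int_mul_two_pi_mul_I _)
  rw [h1.1, h1.2] at e
  have h2 : ((n * x.den * y.den : ℤ) : ℂ) = 0 := by
    refine (mul_eq_zero.1 (e.symm.trans (by simp))).resolve_right ?_
    simp [Real.pi_ne_zero]
  have h3 : n * x.den * y.den = 0 := by exact_mod_cast h2
  simpa using h3

end Rationality

/-! ### Expansion in simple coroots and the two criteria -/

section CorootExpansion

variable {ι V V' : Type*} [Fintype ι] [DecidableEq ι] [AddCommGroup V] [Module ℂ V]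
  [AddCommGroup V'] [Module ℂ V'] {P : RootPairing ι ℂ V V'} [P.IsRootSystem] [P.IsCrystallographic]

lemma form_corootVec_fundWeight (b : P.Base) (i j : b.support) :
    form P (corootVec P i) (fundWeight b j) = if i = j then 1 else 0 := by
  rw [form_comm, form_corootVec, coroot'_fundWeight]
  simp only [eq_comm]

lemma form_sum_corootVec_fundWeight (b : P.Base) (z : b.support → ℂ) (j : b.support) :
    form P (∑ i, z i • corootVec P i) (fundWeight b j) = z j := by
  simp only [form_eq, map_sum, map_smul, LinearMap.sum_apply, LinearMap.smul_apply]
  simp only [← form_eq, form_corootVec_fundWeight]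
  simp

/-- The simple coroots are nonzero multiples of the simple roots, hence span, and they are dual to
the fundamental weights. -/
lemma sum_form_smul_corootVec (b : P.Base) (x : V) :
    ∑ i : b.support, form P x (fundWeight b i) • corootVec P i = x := by
  have h : ∃ z : b.support → ℂ, x = ∑ i, z i • corootVec P i := by
    refine ⟨fun i => b.toWeightBasis.repr x i * halfSq P i, ?_⟩
    conv_lhs => rw [← b.toWeightBasis.sum_repr x]
    refine Finset.sum_congr rfl fun i _ => ?_
    have : (halfSq P i : ℂ) ≠ 0 := Rat.cast_ne_zero.2 (halfSq_ne_zero (i : ι))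
    rw [corootVec_eq, b.toWeightBasis_apply, smul_smul, mul_assoc, Rat.cast_inv,
      mul_inv_cancel₀ this, mul_one]
  obtain ⟨z, hz⟩ := h
  refine Eq.trans (Finset.sum_congr rfl fun i _ => ?_) hz.symm
  rw [hz, form_sum_corootVec_fundWeight]

lemma form_sum_int_corootVec {b : P.Base} (n : b.support → ℤ) {v : V} (hv : v ∈ weightLattice b) :
    ∃ k : ℤ, form P (∑ i, (n i : ℂ) • corootVec P i) v = k := by
  choose l hl using mem_weightLattice_iff.1 hv
  refine ⟨∑ i, n i * l i, ?_⟩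
  rw [form_comm, form_eq, map_sum]
  push_cast
  refine Finset.sum_congr rfl fun i _ => ?_
  rw [map_smul, ← form_eq, form_corootVec, smul_eq_mul, hl]

lemma sum_smul_corootVec_mem_ratWeights {b : P.Base} {β : ℂ} {z : b.support → ℂ}
    (h : ∑ i, z i • corootVec P i ∈ ratWeights b β) (i : b.support) : z i ∈ ratPlane β := by
  obtain ⟨y, hy, hsum⟩ := isRationalWeight_iff.1 h
  have hi : z i * ((halfSq P i)⁻¹ : ℚ) = y i := by
    have := congrArg (fun v => b.toWeightBasis.repr v i) hsum
    simpa only [corootVec_eq, smul_smul, map_sum, map_smul, b.toWeightBasis_repr_root,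
      Finsupp.finsetSum_apply, Finsupp.smul_apply, Finsupp.single_apply, smul_eq_mul, mul_ite,
      mul_one, mul_zero, Finset.sum_ite_eq', Finset.mem_univ, if_true] using this
  have h0 : (halfSq P i : ℂ) ≠ 0 := Rat.cast_ne_zero.2 (halfSq_ne_zero (i : ι))
  have : z i = (halfSq P i : ℂ) * y i := by
    rw [← hi, Rat.cast_inv]
    field_simp
  rw [this]
  exact mul_mem_ratPlane _ (hy i)

variable [P.IsReduced] {b : P.Base} {ħ β : ℂ}

/-- Equality of all eigenvalues amounts to conjugacy under the shifted Weyl group action, up to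
`πi/ħ` times the coroot lattice. -/
theorem highestWeight_eq_iff
    (hgeneric : ∀ m n : ℤ, qPar ħ ^ m * tPar ħ β ^ n = 1 → m = 0 ∧ n = 0)
    {T : b.support → YField b} (hT : ∀ i, IsGenerator ħ β i (T i)) (μ μ' : V) :
    (∀ i, highestWeight ħ β (T i) μ = highestWeight ħ β (T i) μ') ↔
      ∃ (w : P.weylGroup) (n : b.support → ℤ), μ' = shiftedAction b β w μ +
        (Real.pi * Complex.I / ħ : ℂ) • ∑ i : b.support, (n i : ℂ) • corootVec P i := by
  have hħ := ne_zero_of_generic hgeneric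
  constructor
  · intro h
    obtain ⟨w, hw⟩ := exists_exp_eq_of_highestWeight_eq hgeneric hT h
    -- Comparing exponents at `ω_i` gives `2πi n_i`; divided by `2ħ`, this is the `i`-th coroot
    -- coordinate of the difference.
    choose n hn using fun i : b.support =>
      Complex.exp_eq_exp_iff_exists_int.1 (hw _ (fundWeight_mem b i))
    refine ⟨w, n, ?_⟩
    rw [← sub_eq_iff_eq_add', ← sum_form_smul_corootVec b (μ' - _), Finset.smul_sum]
    refine Finset.sum_congr rfl fun i _ => ?_
    rw [smul_smul]
    congr 1
    have e : μ' - shiftedAction b β w μ =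
        (μ' - weylShift b β) - w • (μ - weylShift b β) := by
      rw [shiftedAction]; abel
    rw [e, form_eq, map_sub, LinearMap.sub_apply, ← form_eq, ← form_eq]
    field_simp
    linear_combination (1 / 2 : ℂ) * hn i
  · rintro ⟨w, n, rfl⟩ i
    refine highestWeight_eq_of_exp_eq hgeneric (hT i).pasted w fun v hv => ?_
    obtain ⟨k, hk⟩ := form_sum_int_corootVec n hv
    refine Complex.exp_eq_exp_iff_exists_int.2 ⟨k, ?_⟩
    rw [shiftedAction, add_right_comm, add_sub_cancel_right, form_eq, map_add,
      LinearMap.map_smul, LinearMap.add_apply, LinearMap.smul_apply, ← form_eq, ← form_eq, hk,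
      smul_eq_mul]
    field_simp

theorem highestWeight_eq_iff_of_rational
    (hgeneric : ∀ m n : ℤ, qPar ħ ^ m * tPar ħ β ^ n = 1 → m = 0 ∧ n = 0)
    {T : b.support → YField b} (hT : ∀ i, IsGenerator ħ β i (T i)) {μ μ' : V}
    (hμ : IsRationalWeight b β μ) (hμ' : IsRationalWeight b β μ') :
    (∀ i, highestWeight ħ β (T i) μ = highestWeight ħ β (T i) μ') ↔
      ∃ w : P.weylGroup, μ' = shiftedAction b β w μ := by
  rw [highestWeight_eq_iff hgeneric hT]
  constructor
  · rintro ⟨w, n, h⟩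
    refine ⟨w, ?_⟩
    -- The ambiguity is a difference of two elements of `P_ℚ + β P_ℚ`, so its coroot coordinates lie
    -- in `ℚ + β ℚ`.
    have hmem : ∑ i : b.support, (Real.pi * Complex.I / ħ * n i) • corootVec P i ∈
        ratWeights b β := by
      simp only [mul_smul, ← Finset.smul_sum]
      rw [eq_sub_iff_add_eq'.2 h.symm]
      exact sub_mem hμ' (shiftedAction_mem_ratWeights w hμ)
    have hn : ∀ i, n i = 0 := fun i =>
      eq_zero_of_int_mul_pi_mem hgeneric (sum_smul_corootVec_mem_ratWeights hmem i)
    simpa [hn] using h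
  · rintro ⟨w, h⟩
    exact ⟨w, fun _ => 0, by simpa using h⟩

end CorootExpansion

end DeformedW

end

theorem lemma2p8 {ι V V' : Type*} [Fintype ι] [DecidableEq ι]
    [AddCommGroup V] [Module ℂ V] [AddCommGroup V'] [Module ℂ V']
    (P : RootPairing ι ℂ V V') [P.IsRootSystem] [P.IsCrystallographic] [P.IsReduced]
    [P.IsIrreducible] (b : P.Base) (ħ β : ℂ)
    (hgeneric : ∀ m n : ℤ, DeformedW.qPar ħ ^ m * DeformedW.tPar ħ β ^ n = 1 → m = 0 ∧ n = 0)
    (T : b.support → DeformedW.YField b)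
    (hT : ∀ i, DeformedW.IsGenerator ħ β i (T i)) :
    (∀ (i : b.support) (μ : V), DeformedW.fieldMode ħ β μ (T i) 0 1 =
      DeformedW.highestWeight ħ β (T i) μ • (1 : DeformedW.Fock b)) ∧
    (∀ μ μ' : V,
      (∀ i : b.support,
        DeformedW.highestWeight ħ β (T i) μ = DeformedW.highestWeight ħ β (T i) μ') ↔
      ∃ (w : P.weylGroup) (n : b.support → ℤ),
        μ' = DeformedW.shiftedAction b β w μ +
          ((Real.pi * Complex.I / ħ : ℂ)) •
            ∑ i : b.support, (n i : ℂ) • DeformedW.corootVec P i) ∧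
    (∀ μ μ' : V, DeformedW.IsRationalWeight b β μ → DeformedW.IsRationalWeight b β μ' →
      ((∀ i : b.support,
        DeformedW.highestWeight ħ β (T i) μ = DeformedW.highestWeight ħ β (T i) μ') ↔
      ∃ w : P.weylGroup, μ' = DeformedW.shiftedAction b β w μ)) := by
  refine ⟨fun i μ => ?_, DeformedW.highestWeight_eq_iff hgeneric hT,
    fun μ μ' => DeformedW.highestWeight_eq_iff_of_rational hgeneric hT⟩
  rw [DeformedW.highestWeight_eq_sum, DeformedW.fieldMode_zero_one]
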